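/- Consider $n\ge 1$ agents (more precisely, $n$ pairs of agents, one of each pair in each of two completely identical subnetworks), nonempty closed convex sets $X\subseteq\mathbb{R}^{m_1}$, $Y\subseteq\mathbb{R}^{m_2}$, and functions $f_1,\dots,f_n:\mathbb{R}^{m_1}\times\mathbb{R}^{m_2}\to\mathbb{R}$, each strictly convex in its first and strictly concave in its second argument. A saddle point of $\phi$ on $X\times Y$ is a pair $(x^*,y^*)\in X\times Y$ with $\phi(x^*,y)\le\phi(x^*,y^*)\le\phi(x,y^*)$ for all $x\in X$, $y\in Y$. Suppose that (A1) for every $\mu\in\mathbb{R}^n$ with $\mu_i\ge 0$ and $\sum_i\mu_i=1$, the function $\sum_i\mu_if_i$ has at least one saddle point on $X\times Y$; (A4) there is $L>0$ with $|q|\le L$ for all $i$, all $(x,y)\in X\times Y$ and all $q\in\partial_xf_i(x,y)\cup\partial_yf_i(x,y)$ (the subdifferential of the convex function $f_i(\cdot,y)$ at $x$ and that of the concave function $f_i(x,\cdot)$ at $y$); (A5) the stepsizes $\gamma_k>0$, $k=0,1,\dots$, are non-increasing with $\sum_k\gamma_k=\infty$ and $\sum_k\gamma_k^2<\infty$. A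 switching digraph sequence consists of weighted digraphs on $\{1,\dots,n\}$ with self-loops, one for each time $k\ge 0$, with weights $a_{ij}(k)\ge 0$, where $a_{ij}(k)>0$ if and only if $(j,i)$ is an arc at time $k$. It satisfies the weight rule (A3) if there is $0<\eta<1$ such that $a_{ij}(k)\ge\eta$ for all $k$ and all arcs $(j,i)$ at time $k$, and $\sum_ja_{ij}(k)=1$ for all $i,k$. It is uniformly jointly strongly connected (UJSC) if there is an integer $T>0$ such that for every $k\ge 0$ the union of the digraphs at the times $k,\dots,k+T-1$ is strongly connected. Along such a sequence, with $P_X$, $P_Y$ the Euclidean projections, consider the algorithm $$x_i(k+1)=P_X\big(\hat x_i(k)-\gamma_kq_{1i}(k)\big),\qquad y_i(k+1)=P_Y\big(\hat y_i(k)+\gamma_kq_{2i}(k)\big),\qquad i=1,\dots,n,$$ where $\hat x_i(k)=\sum_ja_{ij}(k)x_j(k)$, $\hat y_i(k)=\sum_ja_{ij}(k)y_j(k)$, $q_{1i}(k)\in\partial_xf_i(\hat x_i(k),y_i(k))$ and $q_{2i}(k)\in\partial_yf_i(x_i(k),\hat y_i(k))$. The network achieves a Nash equilibrium if for all initial states $x_i(0)\in\mathbb{R}^{m_1}$,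 $y_i(0)\in\mathbb{R}^{m_2}$ (and all choices of the subgradients) there is a saddle point $(x^*,y^*)$ of $\sum_{i=1}^nf_i$ on $X\times Y$ such that $\lim_{k\to\infty}x_i(k)=x^*$ and $\lim_{k\to\infty}y_i(k)=y^*$ for all $i$. Then the network achieves a Nash equilibrium by this algorithm for every UJSC switching digraph sequence that satisfies the weight rule if and only if $f_1,\dots,f_n$ have the same saddle point on $X\times Y$. -/

import Mathlib

open Filter Topology

/-- `p` is the metric projection `P_K(z)` of `z` onto `K`: a point of `K` at which the infimum of
the distances from `z` to the points of `K` is attained. -/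
def IsProj {E : Type*} [NormedAddCommGroup E] (K : Set E) (z p : E) : Prop :=
  p ∈ K ∧ ‖z - p‖ = ⨅ w : K, ‖z - w‖

/-- On a nonempty closed convex set of a Euclidean space every point has exactly one metric
projection, so that the relation `IsProj K` is the graph of the operator `P_K`. -/
theorem existsUnique_isProj {m : ℕ} {K : Set (EuclideanSpace ℝ (Fin m))} (hne : K.Nonempty)
    (hcl : IsClosed K) (hcv : Convex ℝ K) (z : EuclideanSpace ℝ (Fin m)) :
    ∃! p, IsProj K z p := by
  obtain ⟨p, hp, hpe⟩ := exists_norm_eq_iInf_of_complete_convex hne hcl.isComplete hcv z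
  refine ⟨p, ⟨hp, hpe⟩, ?_⟩
  rintro q ⟨hq, hqe⟩
  have h1 := (norm_eq_iInf_iff_real_inner_le_zero hcv hp).1 hpe q hq
  have h2 := (norm_eq_iInf_iff_real_inner_le_zero hcv hq).1 hqe p hp
  have h3 : inner ℝ (q - p) (q - p) ≤ 0 := by
    have e : inner ℝ (q - p) (q - p) = inner ℝ (z - p) (q - p) + inner ℝ (z - q) (p - q) := by
      rw [← neg_sub q p, inner_neg_right, ← sub_eq_add_neg, ← inner_sub_left]
      congr 1
      abel
    linarith
  exact sub_eq_zero.1 (inner_self_eq_zero.1 (le_antisymm h3 real_inner_self_nonneg))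

/-- The subdifferential of a convex function `φ` at `z₀`. -/
def subdiffConvex {E : Type*} [NormedAddCommGroup E] [InnerProductSpace ℝ E]
    (φ : E → ℝ) (z₀ : E) : Set E :=
  {v | ∀ z, φ z₀ + inner ℝ (z - z₀) v ≤ φ z}

/-- The subdifferential of a concave function `φ` at `z₀`. -/
def subdiffConcave {E : Type*} [NormedAddCommGroup E] [InnerProductSpace ℝ E]
    (φ : E → ℝ) (z₀ : E) : Set E :=
  {v | ∀ z, φ z ≤ φ z₀ + inner ℝ (z - z₀) v}

/-- `φ` is strictly convex-concave on the whole space: strictly convex in the first argument and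
strictly concave in the second one. -/
def StrictlyConvexConcave {E F : Type*} [NormedAddCommGroup E] [NormedSpace ℝ E]
    [NormedAddCommGroup F] [NormedSpace ℝ F] (φ : E → F → ℝ) : Prop :=
  (∀ y, StrictConvexOn ℝ Set.univ fun x => φ x y) ∧
    ∀ x, StrictConcaveOn ℝ Set.univ fun y => φ x y

/-- `(a, b) ∈ X × Y` is a saddle point of `φ` on `X × Y`:
`φ a y ≤ φ a b ≤ φ x b` for all `x ∈ X` and `y ∈ Y`. -/
def IsSaddle {E F : Type*} (X : Set E) (Y : Set F) (φ : E → F → ℝ) (a : E) (b : F) : Prop :=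
  a ∈ X ∧ b ∈ Y ∧ (∀ y ∈ Y, φ a y ≤ φ a b) ∧ ∀ x ∈ X, φ a b ≤ φ x b

/-- A weighted digraph with self-loops on the nodes `Fin n`, given by its adjacency matrix:
the entry `weight i j` is positive if and only if `(j, i)` is an arc, and it is zero otherwise. -/
structure WeightedDigraph (n : ℕ) where
  weight : Matrix (Fin n) (Fin n) ℝ
  weight_nonneg : ∀ i j, 0 ≤ weight i j
  self_loop : ∀ i, 0 < weight i i

/-- `(j, i)` is an arc of the digraph, i.e. `j` is a neighbor of `i`. -/
def WeightedDigraph.Arc {n : ℕ} (G : WeightedDigraph n) (j i : Fin n) : Prop :=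
  0 < G.weight i j

/-- The arcs of the union over the times `k₁ ≤ s < k₂` of a switching digraph sequence. -/
def UnionArc {n : ℕ} (G : ℕ → WeightedDigraph n) (k₁ k₂ : ℕ) (j i : Fin n) : Prop :=
  ∃ s, k₁ ≤ s ∧ s < k₂ ∧ (G s).Arc j i

/-- The digraph with the given arcs is strongly connected: there is a directed path from every
node to every node. -/
def StronglyConnected {n : ℕ} (arc : Fin n → Fin n → Prop) : Prop :=
  ∀ i j, Relation.ReflTransGen arc i j

/-- The switching digraph sequence is uniformly jointly strongly connected. -/
def UJSC {n : ℕ} (G : ℕ → WeightedDigraph n) : Prop :=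
  ∃ T : ℕ, 0 < T ∧ ∀ k, StronglyConnected (UnionArc G k (k + T))

/-- The weight rule: the weights of all arcs at all times have a common lower bound `η ∈ (0, 1)`,
and the weights of the arcs that enter a node sum up to one. -/
def WeightRule {n : ℕ} (G : ℕ → WeightedDigraph n) : Prop :=
  (∃ η : ℝ, 0 < η ∧ η < 1 ∧ ∀ k i j, (G k).Arc j i → η ≤ (G k).weight i j) ∧
    ∀ k i, ∑ j, (G k).weight i j = 1

/-- The rule for the homogeneous stepsizes. -/
def StepsizeRule (γ : ℕ → ℝ) : Prop :=
  (∀ k, 0 < γ k) ∧ Antitone γ ∧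
    Tendsto (fun N => ∑ k ∈ Finset.range N, γ k) atTop atTop ∧
    Summable fun k => γ k ^ 2

/-- Every weighted average of the functions `f i`, with a stochastic weight vector, has a saddle
point on `X × Y`. -/
def SaddlePointsExist {E F : Type*} {n : ℕ} (X : Set E) (Y : Set F)
    (f : Fin n → E → F → ℝ) : Prop :=
  ∀ μ ∈ stdSimplex ℝ (Fin n), ∃ a b, IsSaddle X Y (fun x y => ∑ i, μ i * f i x y) a b

/-- The subgradients of all `f i` at all points of `X × Y` are bounded by a common constant. -/
def BoundedSubgradients {E F : Type*} [NormedAddCommGroup E] [InnerProductSpace ℝ E]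
    [NormedAddCommGroup F] [InnerProductSpace ℝ F] {n : ℕ} (X : Set E) (Y : Set F)
    (f : Fin n → E → F → ℝ) : Prop :=
  ∃ L : ℝ, 0 < L ∧ ∀ i, ∀ x ∈ X, ∀ y ∈ Y,
    (∀ q ∈ subdiffConvex (fun x' => f i x' y) x, ‖q‖ ≤ L) ∧
      ∀ q ∈ subdiffConcave (fun y' => f i x y') y, ‖q‖ ≤ L

/-- `(x k i, y k i)`, the states of the pair of agents `i` at time `k`, evolve by the homogeneous
projected subgradient algorithm with stepsizes `γ`, along the switching digraphs `G`, for some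
choice of the subgradients. The initial states are arbitrary points of the whole spaces. -/
def IsTrajectory {E F : Type*} [NormedAddCommGroup E] [InnerProductSpace ℝ E]
    [NormedAddCommGroup F] [InnerProductSpace ℝ F] {n : ℕ} (X : Set E) (Y : Set F)
    (f : Fin n → E → F → ℝ) (G : ℕ → WeightedDigraph n) (γ : ℕ → ℝ)
    (x : ℕ → Fin n → E) (y : ℕ → Fin n → F) : Prop :=
  ∀ k i,
    (∃ q ∈ subdiffConvex (fun x' => f i x' (y k i)) (∑ j, (G k).weight i j • x k j),
      IsProj X ((∑ j, (G k).weight i j • x k j) - γ k • q) (x (k + 1) i)) ∧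
    ∃ q ∈ subdiffConcave (fun y' => f i (x k i) y') (∑ j, (G k).weight i j • y k j),
      IsProj Y ((∑ j, (G k).weight i j • y k j) + γ k • q) (y (k + 1) i)

/-- The network achieves a Nash equilibrium: from all initial states (and for all choices of the
subgradients), the states of all agents of the first subnetwork converge to a common point `a` and
those of the second one to a common point `b`, where `(a, b)` is a saddle point on `X × Y` of the
sum `U` of the objective functions, i.e. a Nash equilibrium of the zero-sum game. -/
def AchievesNash {E F : Type*} [NormedAddCommGroup E] [InnerProductSpace ℝ E]
    [NormedAddCommGroup F] [InnerProductSpace ℝ F] {n : ℕ} (X : Set E) (Y : Set F)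
    (f : Fin n → E → F → ℝ) (G : ℕ → WeightedDigraph n) (γ : ℕ → ℝ) : Prop :=
  ∀ (x : ℕ → Fin n → E) (y : ℕ → Fin n → F), IsTrajectory X Y f G γ x y →
    ∃ a b, IsSaddle X Y (fun x' y' => ∑ i, f i x' y') a b ∧
      (∀ i, Tendsto (fun k => x k i) atTop (𝓝 a)) ∧
      ∀ i, Tendsto (fun k => y k i) atTop (𝓝 b)

/-!
Sufficiency. By the weight rule and joint strong connectivity, the products of the averaging
matrices over long enough windows have entries bounded away from zero, so they contract the
disagreement of the agents by a fixed factor; as each subgradient step has size `O(γ k)`, the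
disagreement is square summable. If `(a, b)` is a saddle point of every `f i`, then the largest
squared distance `M k` of a pair of agents to `(a, b)` satisfies
`M (k + 1) ≤ M k - 2 * γ k * c k + ε k`, with `ε` summable and `c k` the least of the gaps
`f i (x k i) b - f i a (y k i)`. Hence `M` converges. If its limit were positive, all agents would
eventually stay in a compact annulus around `(a, b)`, on which strict convexity-concavity bounds the
gaps below by a positive constant, contradicting the divergence of the series of stepsizes.

Necessity. Let every agent give the weight `μ j > 0` to agent `j`, at all times. Each step then
starts from the `μ`-average of the states, and the descent estimate for the `μ`-weighted sum of the
squared distances shows that the limit of the states is a saddle point of `∑ i, μ i * f i`. That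
limit is the unique saddle point of `∑ i, f i`, so it does not depend on `μ`; let `μ` tend to the
`i`-th vertex of the simplex.
-/

section Averaging

variable {ι E : Type*} [NormedAddCommGroup E]

/-- The disagreement of the agents with states `z i`: the largest distance between two of them. -/
noncomputable def disagreement (z : ι → E) : ℝ := Metric.diam (Set.range z)

theorem disagreement_nonneg (z : ι → E) : 0 ≤ disagreement z := Metric.diam_nonneg

theorem disagreement_le {z : ι → E} {r : ℝ} (hr : 0 ≤ r) (h : ∀ i j, ‖z i - z j‖ ≤ r) :
    disagreement z ≤ r := by
  refine Metric.diam_le_of_forall_dist_le hr ?_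
  rintro _ ⟨i, rfl⟩ _ ⟨j, rfl⟩
  exact (dist_eq_norm (z i) (z j)).trans_le (h i j)

theorem norm_sub_le_disagreement [Finite ι] (z : ι → E) (i j : ι) :
    ‖z i - z j‖ ≤ disagreement z := by
  rw [← dist_eq_norm]
  exact Metric.dist_le_diam_of_mem (Set.finite_range z).isBounded ⟨i, rfl⟩ ⟨j, rfl⟩

theorem norm_sub_le_disagreement_of_mem_convexHull [NormedSpace ℝ E] [Finite ι]
    {z : ι → E} {p q : E} (hp : p ∈ convexHull ℝ (Set.range z))
    (hq : q ∈ convexHull ℝ (Set.range z)) :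
    ‖p - q‖ ≤ disagreement z := by
  rw [← dist_eq_norm, disagreement, ← convexHull_diam]
  exact Metric.dist_le_diam_of_mem
    (isBounded_convexHull.2 (Set.finite_range z).isBounded) hp hq

variable [Fintype ι]

theorem exists_norm_apply_eq_norm [Nonempty ι] (z : ι → E) : ∃ i, ‖z i‖ = ‖z‖ := by
  obtain ⟨i, hi⟩ := Finite.exists_max fun i => ‖z i‖
  exact ⟨i, (norm_le_pi_norm z i).antisymm ((pi_norm_le_iff_of_nonempty z).2 hi)⟩

theorem disagreement_le_add_norm_sub (z w : ι → E) :
    disagreement z ≤ disagreement w + 2 * ‖z - w‖ := by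
  refine disagreement_le (add_nonneg (disagreement_nonneg w) (by positivity)) fun i j => ?_
  have hi : ‖z i - w i‖ ≤ ‖z - w‖ := norm_le_pi_norm (z - w) i
  have hj : ‖z j - w j‖ ≤ ‖z - w‖ := norm_le_pi_norm (z - w) j
  have hij := norm_sub_le_disagreement w i j
  calc ‖z i - z j‖ = ‖(z i - w i) + (w i - w j) - (z j - w j)‖ := by congr 1; abel
    _ ≤ ‖z i - w i‖ + ‖w i - w j‖ + ‖z j - w j‖ :=
      (norm_sub_le _ _).trans (add_le_add_left (norm_add_le _ _) _)
    _ ≤ disagreement w + 2 * ‖z - w‖ := by linarith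

theorem norm_sub_const_le_add_disagreement (z : ι → E) (w : E) (i : ι) :
    ‖z - Function.const ι w‖ ≤ ‖z i - w‖ + disagreement z := by
  refine (pi_norm_le_iff_of_nonneg (add_nonneg (norm_nonneg _) (disagreement_nonneg z))).2
    fun j => ?_
  calc ‖z j - w‖ ≤ ‖z i - w‖ + ‖z j - z i‖ := by
        rw [add_comm]
        exact norm_sub_le_norm_sub_add_norm_sub _ _ _
    _ ≤ ‖z i - w‖ + disagreement z := by
        gcongr
        exact norm_sub_le_disagreement z j i

variable [NormedSpace ℝ E]

theorem norm_sum_smul_sub_sum_smul_le {u v : ι → ℝ} (hu : ∀ i, 0 ≤ u i) (hv : ∀ i, 0 ≤ v i)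
    {c : ℝ} (hu_sum : ∑ i, u i = c) (hv_sum : ∑ i, v i = c) (z : ι → E) :
    ‖(∑ i, u i • z i) - ∑ i, v i • z i‖ ≤ c * disagreement z := by
  have hc : 0 ≤ c := hu_sum ▸ Finset.sum_nonneg fun i _ => hu i
  rcases hc.eq_or_lt with rfl | hc
  · have hu_zero := (Finset.sum_eq_zero_iff_of_nonneg fun i _ => hu i).1 hu_sum
    have hv_zero := (Finset.sum_eq_zero_iff_of_nonneg fun i _ => hv i).1 hv_sum
    simp only [Finset.mem_univ, true_imp_iff] at hu_zero hv_zero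
    simp [hu_zero, hv_zero]
  · have mem_hull : ∀ w : ι → ℝ, (∀ i, 0 ≤ w i) → ∑ i, w i = c →
        c⁻¹ • ∑ i, w i • z i ∈ convexHull ℝ (Set.range z) := by
      intro w hw hw_sum
      have := Finset.centerMass_mem_convexHull (R := ℝ) (s := Set.range z) Finset.univ (w := w)
        (z := z) (fun i _ => hw i) (hw_sum ▸ hc) fun i _ => Set.mem_range_self i
      rwa [Finset.centerMass, hw_sum] at this
    have h := norm_sub_le_disagreement_of_mem_convexHull
      (mem_hull u hu hu_sum) (mem_hull v hv hv_sum)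
    rwa [← smul_sub, norm_smul, norm_inv, Real.norm_of_nonneg hc.le, inv_mul_le_iff₀ hc] at h

variable [DecidableEq ι] {A : Matrix ι ι ℝ}

open scoped Matrix.Module

theorem smul_apply_mem_of_mem_rowStochastic (hA : A ∈ Matrix.rowStochastic ℝ ι) {K : Set E}
    (hK : Convex ℝ K) {z : ι → E} (hz : ∀ i, z i ∈ K) (i : ι) : (A • z) i ∈ K :=
  hK.sum_mem (fun _ _ => Matrix.nonneg_of_mem_rowStochastic hA)
    (Matrix.sum_row_of_mem_rowStochastic hA i) fun j _ => hz j

theorem norm_smul_apply_sub_le (hA : A ∈ Matrix.rowStochastic ℝ ι) (z : ι → E) (w : E) (i : ι) :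
    ‖(A • z) i - w‖ ≤ ‖z - Function.const ι w‖ := by
  rw [← mem_closedBall_iff_norm]
  exact smul_apply_mem_of_mem_rowStochastic hA (convex_closedBall w _)
    (fun j => mem_closedBall_iff_norm.2 (norm_le_pi_norm (z - Function.const ι w) j)) i

theorem norm_smul_le_of_mem_rowStochastic (hA : A ∈ Matrix.rowStochastic ℝ ι) (z : ι → E) :
    ‖A • z‖ ≤ ‖z‖ :=
  (pi_norm_le_iff_of_nonneg (norm_nonneg z)).2 fun i => by
    simpa using norm_smul_apply_sub_le hA z 0 i

theorem norm_smul_apply_sub_le_disagreement (hA : A ∈ Matrix.rowStochastic ℝ ι) (z : ι → E)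
    (i j : ι) : ‖(A • z) i - z j‖ ≤ disagreement z :=
  norm_sub_le_disagreement_of_mem_convexHull
    (smul_apply_mem_of_mem_rowStochastic hA (convex_convexHull ℝ _)
      (fun l => subset_convexHull ℝ _ (Set.mem_range_self l)) i)
    (subset_convexHull ℝ _ (Set.mem_range_self j))

theorem disagreement_smul_le (hA : A ∈ Matrix.rowStochastic ℝ ι) {δ : ℝ} {j₀ : ι}
    (hδ : ∀ i, δ ≤ A i j₀) (z : ι → E) :
    disagreement (A • z) ≤ (1 - δ) * disagreement z := by
  have hδ_le : δ ≤ 1 := (hδ j₀).trans (Matrix.le_one_of_mem_rowStochastic hA)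
  refine disagreement_le (mul_nonneg (sub_nonneg.2 hδ_le) (disagreement_nonneg z)) fun i j => ?_
  -- Mass `δ` sits at `j₀` in every row; it cancels in the difference of two rows.
  let w : ι → ι → ℝ := fun i l => A i l - Pi.single (M := fun _ => ℝ) j₀ δ l
  have hw : ∀ i l, 0 ≤ w i l := by
    intro i l
    rcases eq_or_ne l j₀ with rfl | hl
    · simpa [w] using hδ i
    · simpa [w, hl] using Matrix.nonneg_of_mem_rowStochastic hA
  have hw_sum : ∀ i, ∑ l, w i l = 1 - δ := fun i => by
    simp [w, Matrix.sum_row_of_mem_rowStochastic hA]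
  have h := norm_sum_smul_sub_sum_smul_le (hw i) (hw j) (hw_sum i) (hw_sum j) z
  simpa [w, sub_smul, Pi.single_apply, ite_smul] using h

/-- The product of the averaging matrices `A k` at the times `s, …, s + t - 1`, the latest one on
the left, which carries the states at time `s` to those at time `s + t`. -/
def transitionMatrix (A : ℕ → Matrix ι ι ℝ) (s : ℕ) : ℕ → Matrix ι ι ℝ
  | 0 => 1
  | t + 1 => A (s + t) * transitionMatrix A s t

theorem transitionMatrix_mem_rowStochastic {A : ℕ → Matrix ι ι ℝ}
    (hA : ∀ k, A k ∈ Matrix.rowStochastic ℝ ι) (s t : ℕ) :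
    transitionMatrix A s t ∈ Matrix.rowStochastic ℝ ι := by
  induction t with
  | zero => exact one_mem _
  | succ t ih => exact mul_mem (hA (s + t)) ih

theorem norm_sub_transitionMatrix_smul_le {A : ℕ → Matrix ι ι ℝ}
    (hA : ∀ k, A k ∈ Matrix.rowStochastic ℝ ι) {z : ℕ → ι → E} {e : ℕ → ℝ}
    (hz : ∀ k, ‖z (k + 1) - A k • z k‖ ≤ e k) (s t : ℕ) :
    ‖z (s + t) - transitionMatrix A s t • z s‖ ≤ ∑ r ∈ Finset.range t, e (s + r) := by
  induction t with
  | zero => simp [transitionMatrix]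
  | succ t ih =>
    rw [transitionMatrix, mul_smul, ← sub_add_sub_cancel _ (A (s + t) • z (s + t)), ← smul_sub,
      Finset.sum_range_succ, add_comm (∑ r ∈ _, _)]
    exact norm_add_le_of_le (hz (s + t)) ((norm_smul_le_of_mem_rowStochastic (hA _) _).trans ih)

end Averaging

section Series

theorem summable_of_add_le_mul_add {u v : ℕ → ℝ} {ρ : ℝ} {B : ℕ} (hu : ∀ k, 0 ≤ u k)
    (hv_nonneg : ∀ k, 0 ≤ v k) (hv : Summable v) (hρ : ρ < 1)
    (h : ∀ k, u (k + B) ≤ ρ * u k + v k) : Summable u := by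
  refine summable_of_sum_range_le (c := (∑ k ∈ Finset.range B, u k + ∑' k, v k) / (1 - ρ)) hu
    fun N => ?_
  rw [le_div_iff₀ (by linarith)]
  have sum_le : ∑ k ∈ Finset.range N, u k
      ≤ ∑ k ∈ Finset.range B, u k + ∑ k ∈ Finset.range N, u (B + k) := by
    rw [← Finset.sum_range_add]
    exact Finset.sum_le_sum_of_subset_of_nonneg (Finset.range_mono (Nat.le_add_left _ _))
      fun i _ _ => hu i
  have sum_shift_le : ∑ k ∈ Finset.range N, u (B + k)
      ≤ ρ * ∑ k ∈ Finset.range N, u k + ∑ k ∈ Finset.range N, v k := by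
    rw [Finset.mul_sum, ← Finset.sum_add_distrib]
    exact Finset.sum_le_sum fun k _ => add_comm k B ▸ h k
  linarith [hv.sum_le_tsum (Finset.range N) fun i _ => hv_nonneg i]

theorem summable_sq_of_add_le_mul_add {d e : ℕ → ℝ} {ρ : ℝ} {B : ℕ} (hd : ∀ k, 0 ≤ d k)
    (he : Summable fun k => e k ^ 2) (hρ_nonneg : 0 ≤ ρ) (hρ : ρ < 1)
    (h : ∀ k, d (k + B) ≤ ρ * d k + e k) : Summable fun k => d k ^ 2 := by
  have hρ_sub : 0 < 1 - ρ := sub_pos.2 hρ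
  refine summable_of_add_le_mul_add (fun k => sq_nonneg _)
    (fun k => mul_nonneg (inv_nonneg.2 hρ_sub.le) (sq_nonneg _)) (he.mul_left (1 - ρ)⁻¹) hρ
    fun k => (pow_le_pow_left₀ (hd _) (h k) 2).trans ?_
  -- Jensen for the square at `d k` and `e k / (1 - ρ)`, with the weights `ρ` and `1 - ρ`.
  rw [← sub_nonneg]
  calc 0 ≤ ρ * (1 - ρ) * (d k - (1 - ρ)⁻¹ * e k) ^ 2 := by positivity
    _ = ρ * d k ^ 2 + (1 - ρ)⁻¹ * e k ^ 2 - (ρ * d k + e k) ^ 2 := by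
      field_simp
      ring

theorem summable_sq_sum_range_add {e : ℕ → ℝ} (he : Summable fun k => e k ^ 2) (B : ℕ) :
    Summable fun k => (∑ r ∈ Finset.range B, e (k + r)) ^ 2 := by
  refine Summable.of_nonneg_of_le (fun k => sq_nonneg _) (fun k => sq_sum_le_card_mul_sum_sq)
    (Summable.mul_left _ (summable_sum fun r _ => ?_))
  exact (summable_nat_add_iff (f := fun k => e k ^ 2) r).2 he

theorem exists_tendsto_of_le_add {M ε : ℕ → ℝ} (hM : ∀ k, 0 ≤ M k) (hε : Summable ε)
    (h : ∀ k, M (k + 1) ≤ M k + ε k) : ∃ ξ, Tendsto M atTop (𝓝 ξ) := by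
  have hε_tendsto := hε.hasSum.tendsto_sum_nat
  have h_anti : Antitone fun k => M k - ∑ j ∈ Finset.range k, ε j := by
    refine antitone_nat_of_succ_le fun k => ?_
    rw [Finset.sum_range_succ]
    linarith [h k]
  have h_bdd : BddBelow (Set.range fun k => M k - ∑ j ∈ Finset.range k, ε j) := by
    obtain ⟨C, hC⟩ := hε_tendsto.bddAbove_range
    refine ⟨-C, ?_⟩
    rintro _ ⟨k, rfl⟩
    linarith [hM k, hC ⟨k, rfl⟩]
  exact ⟨_, ((tendsto_atTop_ciInf h_anti h_bdd).add hε_tendsto).congr fun k =>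
    sub_add_cancel _ _⟩

theorem summable_of_eventually_add_le {M ε δ : ℕ → ℝ} (hM : ∀ k, 0 ≤ M k) (hε : Summable ε)
    (hδ : ∀ k, 0 ≤ δ k) (h : ∀ᶠ k in atTop, M (k + 1) + δ k ≤ M k + ε k) : Summable δ := by
  obtain ⟨N, hN⟩ := eventually_atTop.1 h
  obtain ⟨C, hC⟩ := ((summable_nat_add_iff N).2 hε).hasSum.tendsto_sum_nat.bddAbove_range
  refine (summable_nat_add_iff N).1
    (summable_of_sum_range_le (c := M N + C) (fun k => hδ _) fun t => ?_)
  have telescope : M (t + N) + ∑ k ∈ Finset.range t, δ (k + N)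
      ≤ M N + ∑ k ∈ Finset.range t, ε (k + N) := by
    induction t with
    | zero => simp
    | succ t ih =>
      rw [Finset.sum_range_succ, Finset.sum_range_succ, add_right_comm t 1 N]
      linarith [hN (t + N) (Nat.le_add_left N t)]
  linarith [hM (t + N), hC ⟨t, rfl⟩]

theorem tendsto_zero_of_descent {M ε γ : ℕ → ℝ} (hM : ∀ k, 0 ≤ M k) (hε : Summable ε)
    (hγ : ∀ k, 0 ≤ γ k) (hγ_div : ¬ Summable γ) (h : ∀ k, M (k + 1) ≤ M k + ε k)
    (h_descent : ∀ r > 0, ∃ c > 0, ∀ᶠ k in atTop, r ≤ M k → M (k + 1) + c * γ k ≤ M k + ε k) :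
    Tendsto M atTop (𝓝 0) := by
  obtain ⟨ξ, hξ⟩ := exists_tendsto_of_le_add hM hε h
  rcases (ge_of_tendsto' hξ hM).eq_or_lt with rfl | hξ_pos
  · exact hξ
  obtain ⟨c, hc, hc_descent⟩ := h_descent (ξ / 2) (half_pos hξ_pos)
  refine absurd ?_ hγ_div
  rw [← summable_mul_left_iff hc.ne']
  refine summable_of_eventually_add_le hM hε (fun k => mul_nonneg hc.le (hγ k)) ?_
  filter_upwards [hc_descent, hξ.eventually_const_lt (half_lt_self hξ_pos)] with k hk hk_lt
  exact hk hk_lt.le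

end Series

section Connectivity

variable {n : ℕ} {G : ℕ → WeightedDigraph n}

theorem StronglyConnected.exists_arc_of_mem_of_notMem {arc : Fin n → Fin n → Prop}
    (h : StronglyConnected arc) {S : Set (Fin n)} {j i : Fin n} (hj : j ∈ S) (hi : i ∉ S) :
    ∃ u ∈ S, ∃ v ∉ S, arc u v := by
  induction h j i with
  | refl => exact absurd hj hi
  | @tail u v _ huv ih =>
    by_cases hu : u ∈ S
    · exact ⟨u, hu, v, hi, huv⟩
    · exact ih hu

theorem WeightRule.weight_mem_rowStochastic (hG : WeightRule G) (k : ℕ) :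
    (G k).weight ∈ Matrix.rowStochastic ℝ (Fin n) :=
  Matrix.mem_rowStochastic_iff_sum.2 ⟨(G k).weight_nonneg, hG.2 k⟩

theorem pow_succ_le_transitionMatrix (hG : WeightRule G) {η : ℝ} (hη : 0 ≤ η)
    (hGη : ∀ k i j, (G k).Arc j i → η ≤ (G k).weight i j) {s t : ℕ} {i j l : Fin n}
    (harc : (G (s + t)).Arc l i)
    (h : η ^ t ≤ transitionMatrix (fun k => (G k).weight) s t l j) :
    η ^ (t + 1) ≤ transitionMatrix (fun k => (G k).weight) s (t + 1) i j := by
  have h_nonneg : ∀ m, 0 ≤ transitionMatrix (fun k => (G k).weight) s t m j := fun m =>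
    Matrix.nonneg_of_mem_rowStochastic
      (transitionMatrix_mem_rowStochastic hG.weight_mem_rowStochastic s t)
  rw [transitionMatrix, Matrix.mul_apply, pow_succ']
  exact (mul_le_mul (hGη _ _ _ harc) h (pow_nonneg hη t) ((G _).weight_nonneg _ _)).trans
    (Finset.single_le_sum (f := fun m =>
      (G (s + t)).weight i m * transitionMatrix (fun k => (G k).weight) s t m j)
      (fun m _ => mul_nonneg ((G _).weight_nonneg _ _) (h_nonneg m)) (Finset.mem_univ l))

/-- The agents on whose states at time `s + t` the state of the agent `j` at time `s` has an
influence of at least `η ^ t`. -/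
noncomputable def influencedNodes (G : ℕ → WeightedDigraph n) (η : ℝ) (s : ℕ) (j : Fin n)
    (t : ℕ) : Finset (Fin n) :=
  {i | η ^ t ≤ transitionMatrix (fun k => (G k).weight) s t i j}

theorem mem_influencedNodes {η : ℝ} {s t : ℕ} {i j : Fin n} :
    i ∈ influencedNodes G η s j t ↔
      η ^ t ≤ transitionMatrix (fun k => (G k).weight) s t i j := by
  simp only [influencedNodes, Finset.mem_filter_univ]

theorem influencedNodes_mono (hG : WeightRule G) {η : ℝ} (hη : 0 ≤ η)
    (hGη : ∀ k i j, (G k).Arc j i → η ≤ (G k).weight i j) (s : ℕ) (j : Fin n) :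
    Monotone (influencedNodes G η s j) :=
  monotone_nat_of_le_succ fun t i hi => mem_influencedNodes.2
    (pow_succ_le_transitionMatrix hG hη hGη ((G (s + t)).self_loop i) (mem_influencedNodes.1 hi))

theorem influencedNodes_ssubset (hG : WeightRule G) {η : ℝ} (hη : 0 ≤ η)
    (hGη : ∀ k i j, (G k).Arc j i → η ≤ (G k).weight i j) {T s t : ℕ} {j : Fin n}
    (hT : StronglyConnected (UnionArc G (s + t) (s + t + T)))
    (hne : influencedNodes G η s j t ≠ Finset.univ) :
    influencedNodes G η s j t ⊂ influencedNodes G η s j (t + T) := by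
  have mono := influencedNodes_mono hG hη hGη s j
  have hj : j ∈ influencedNodes G η s j t :=
    mono t.zero_le (mem_influencedNodes.2 (by simp [transitionMatrix]))
  obtain ⟨i, hi⟩ : ∃ i, i ∉ influencedNodes G η s j t := by
    simpa [Finset.eq_univ_iff_forall] using hne
  obtain ⟨u, hu, v, hv, τ, hτ_ge, hτ_lt, harc⟩ := hT.exists_arc_of_mem_of_notMem
    (S := ↑(influencedNodes G η s j t)) (Finset.mem_coe.2 hj) (Finset.mem_coe.not.2 hi)
  obtain ⟨r, rfl⟩ := Nat.exists_eq_add_of_le hτ_ge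
  rw [add_assoc] at harc
  have hv_mem : v ∈ influencedNodes G η s j (t + r + 1) :=
    mem_influencedNodes.2 (pow_succ_le_transitionMatrix hG hη hGη harc
      (mem_influencedNodes.1 (mono (Nat.le_add_right t r) hu)))
  exact Finset.ssubset_iff_subset_ne.2 ⟨mono (Nat.le_add_right t T), fun h =>
    hv (h.symm ▸ mono (by lia) hv_mem)⟩

theorem apply_card_eq_univ_of_ssubset {α : Type*} [Fintype α] {S : ℕ → Finset α}
    (hS : Monotone S) (h : ∀ m, S m ≠ Finset.univ → S m ⊂ S (m + 1)) :
    S (Fintype.card α) = Finset.univ := by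
  have key : ∀ m, S m = Finset.univ ∨ m ≤ (S m).card := by
    intro m
    induction m with
    | zero => exact .inr (Nat.zero_le _)
    | succ m ih =>
      rcases eq_or_ne (S m) Finset.univ with hm | hm
      · exact .inl (Finset.univ_subset_iff.1 (hm ▸ hS m.le_succ))
      · exact .inr ((ih.resolve_left hm).trans_lt (Finset.card_lt_card (h m hm)))
  exact (key _).elim id fun hcard =>
    Finset.eq_univ_of_card _ ((Finset.card_le_univ _).antisymm hcard)

theorem UJSC.exists_forall_le_transitionMatrix (hU : UJSC G) (hG : WeightRule G) :
    ∃ B : ℕ, ∃ δ > 0, ∀ s i j, δ ≤ transitionMatrix (fun k => (G k).weight) s B i j := by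
  obtain ⟨T, -, hT⟩ := hU
  obtain ⟨η, hη, -, hGη⟩ := hG.1
  refine ⟨Fintype.card (Fin n) * T, η ^ (Fintype.card (Fin n) * T), by positivity,
    fun s i j => mem_influencedNodes.1 ?_⟩
  have h_univ : influencedNodes G η s j (Fintype.card (Fin n) * T) = Finset.univ := by
    refine apply_card_eq_univ_of_ssubset (S := fun m => influencedNodes G η s j (m * T))
      ((influencedNodes_mono hG hη.le hGη s j).comp fun _ _ hm => Nat.mul_le_mul_right T hm)
      fun m hm => ?_
    rw [Nat.succ_mul]
    exact influencedNodes_ssubset hG hη.le hGη (hT _) hm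
  exact h_univ ▸ Finset.mem_univ i

open scoped Matrix.Module

variable {E : Type*} [NormedAddCommGroup E] [NormedSpace ℝ E]

theorem UJSC.summable_disagreement_sq (hU : UJSC G) (hG : WeightRule G) {e : ℕ → ℝ}
    (he : Summable fun k => e k ^ 2) {z : ℕ → Fin n → E}
    (hz : ∀ k, ‖z (k + 1) - (G k).weight • z k‖ ≤ e k) :
    Summable fun k => disagreement (z k) ^ 2 := by
  rcases isEmpty_or_nonempty (Fin n) with _ | ⟨⟨j₀⟩⟩
  · have h_zero : ∀ k, disagreement (z k) = 0 := fun k =>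
      (disagreement_le le_rfl fun i => isEmptyElim i).antisymm (disagreement_nonneg _)
    simp [h_zero, summable_zero]
  obtain ⟨B, δ, hδ, hB⟩ := hU.exists_forall_le_transitionMatrix hG
  let P := fun s => transitionMatrix (fun k => (G k).weight) s B
  have hP : ∀ s, P s ∈ Matrix.rowStochastic ℝ (Fin n) := fun s =>
    transitionMatrix_mem_rowStochastic hG.weight_mem_rowStochastic s B
  have contraction : ∀ s, disagreement (z (s + B))
      ≤ (1 - δ) * disagreement (z s) + 2 * ∑ r ∈ Finset.range B, e (s + r) := fun s =>
    calc disagreement (z (s + B))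
        ≤ disagreement (P s • z s) + 2 * ‖z (s + B) - P s • z s‖ :=
          disagreement_le_add_norm_sub _ _
      _ ≤ _ := add_le_add (disagreement_smul_le (hP s) (fun i => hB s i j₀) _)
          (mul_le_mul_of_nonneg_left
            (norm_sub_transitionMatrix_smul_le hG.weight_mem_rowStochastic hz s B) zero_le_two)
  have hδ_le : δ ≤ 1 := (hB 0 j₀ j₀).trans (Matrix.le_one_of_mem_rowStochastic (hP 0))
  refine summable_sq_of_add_le_mul_add (fun k => disagreement_nonneg _) ?_
    (sub_nonneg.2 hδ_le) (sub_lt_self 1 hδ) contraction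
  simpa only [mul_pow] using (summable_sq_sum_range_add he B).mul_left (2 ^ 2)

end Connectivity

section Subgradient

theorem exists_add_apply_sub_le_of_convexOn {E : Type*} [NormedAddCommGroup E] [NormedSpace ℝ E]
    {φ : E → ℝ} (hφ : ConvexOn ℝ Set.univ φ) (hφ_cont : Continuous φ) (z₀ : E) :
    ∃ u : StrongDual ℝ E, ∀ z, φ z₀ + u (z - z₀) ≤ φ z := by
  have h_conv : Convex ℝ {p : E × ℝ | φ p.1 < p.2} := by
    simpa using hφ.convex_strict_epigraph
  have h_open : IsOpen {p : E × ℝ | φ p.1 < p.2} :=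
    isOpen_lt (hφ_cont.comp continuous_fst) continuous_snd
  obtain ⟨l, hl⟩ := geometric_hahn_banach_point_open (x := (z₀, φ z₀)) h_conv h_open (by simp)
  let u : StrongDual ℝ E := l.comp (ContinuousLinearMap.inl ℝ E ℝ)
  let c : ℝ := l (0, 1)
  have l_apply : ∀ z t, l (z, t) = u z + t * c := by
    intro z t
    have h_split : ((z, t) : E × ℝ) = (z, 0) + t • (0, 1) := by simp
    rw [h_split, map_add, map_smul, smul_eq_mul]
    rfl
  have hc : 0 < c := by
    have := hl (z₀, φ z₀ + 1) (by simp)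
    rw [l_apply, l_apply] at this
    linarith
  have h_le : ∀ z, u z₀ + φ z₀ * c ≤ u z + φ z * c := by
    intro z
    refine le_of_forall_pos_le_add fun ε hε => ?_
    have := hl (z, φ z + ε / c) (by simpa using div_pos hε hc)
    rw [l_apply, l_apply, add_mul, div_mul_cancel₀ _ hc.ne'] at this
    linarith
  refine ⟨-c⁻¹ • u, fun z => le_of_mul_le_mul_right ?_ hc⟩
  have h_scale : (φ z₀ + (-c⁻¹ • u) (z - z₀)) * c = φ z₀ * c - (u z - u z₀) := by
    rw [smul_apply, smul_eq_mul, map_sub]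
    field_simp
    ring
  linarith [h_le z]

variable {E : Type*} [NormedAddCommGroup E] [InnerProductSpace ℝ E]

theorem mem_subdiffConcave_iff_neg_mem {φ : E → ℝ} {z q : E} :
    q ∈ subdiffConcave φ z ↔ -q ∈ subdiffConvex (fun w => -φ w) z := by
  refine forall_congr' fun w => ?_
  rw [inner_neg_right, ← neg_add, neg_le_neg_iff]

theorem subdiffConvex_nonempty [FiniteDimensional ℝ E] {φ : E → ℝ}
    (hφ : ConvexOn ℝ Set.univ φ) (z₀ : E) : (subdiffConvex φ z₀).Nonempty := by
  obtain ⟨u, hu⟩ := exists_add_apply_sub_le_of_convexOn hφ hφ.locallyLipschitz.continuous z₀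
  have : CompleteSpace E := FiniteDimensional.complete ℝ E
  refine ⟨(InnerProductSpace.toDual ℝ E).symm u, fun z => ?_⟩
  rw [real_inner_comm, InnerProductSpace.toDual_symm_apply]
  exact hu z

theorem sub_le_of_mem_subdiffConvex {φ : E → ℝ} {z w q : E} {L : ℝ}
    (hq : q ∈ subdiffConvex φ z) (hL : ‖q‖ ≤ L) : φ z - φ w ≤ L * ‖z - w‖ :=
  calc φ z - φ w ≤ inner ℝ (z - w) q := by
        rw [← neg_sub w z, inner_neg_left]
        linarith [hq w]
    _ ≤ ‖z - w‖ * ‖q‖ := real_inner_le_norm _ _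
    _ ≤ L * ‖z - w‖ := by
        rw [mul_comm]
        exact mul_le_mul_of_nonneg_right hL (norm_nonneg _)

end Subgradient

section Projection

variable {E : Type*} [NormedAddCommGroup E] [InnerProductSpace ℝ E] {K : Set E}

theorem IsProj.norm_sub_le (hK : Convex ℝ K) {z p w : E} (h : IsProj K z p) (hw : w ∈ K) :
    ‖p - w‖ ≤ ‖z - w‖ := by
  have h_obtuse := (norm_eq_iInf_iff_real_inner_le_zero hK h.1).1 h.2 w hw
  have h_expand := norm_sub_sq_real (z - p) (w - p)
  rw [sub_sub_sub_cancel_right, norm_sub_rev w p] at h_expand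
  exact le_of_sq_le_sq (by linarith [sq_nonneg ‖z - p‖]) (norm_nonneg _)

theorem IsProj.norm_sub_le_of_step (hK : Convex ℝ K) {z p q : E} {γ L : ℝ} (hγ : 0 ≤ γ)
    (hL : ‖q‖ ≤ L) (hz : z ∈ K) (h : IsProj K (z - γ • q) p) : ‖p - z‖ ≤ L * γ := by
  refine (h.norm_sub_le hK hz).trans ?_
  rw [sub_sub_cancel_left, norm_neg, norm_smul, Real.norm_of_nonneg hγ, mul_comm]
  exact mul_le_mul_of_nonneg_right hL hγ

theorem IsProj.norm_sub_sq_le_of_step (hK : Convex ℝ K) {φ : E → ℝ} {z p q w : E} {γ L : ℝ}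
    (hγ : 0 ≤ γ) (hq : q ∈ subdiffConvex φ z) (hL : ‖q‖ ≤ L) (hw : w ∈ K)
    (h : IsProj K (z - γ • q) p) :
    ‖p - w‖ ^ 2 ≤ ‖z - w‖ ^ 2 + L ^ 2 * γ ^ 2 + 2 * γ * (φ w - φ z) := by
  have hq_sq : ‖γ • q‖ ^ 2 ≤ L ^ 2 * γ ^ 2 := by
    rw [norm_smul, Real.norm_of_nonneg hγ, mul_pow, mul_comm]
    exact mul_le_mul_of_nonneg_right (pow_le_pow_left₀ (norm_nonneg q) hL 2) (sq_nonneg γ)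
  have hq_inner : -inner ℝ (z - w) q ≤ φ w - φ z := by
    rw [← inner_neg_left, neg_sub]
    linarith [hq w]
  calc ‖p - w‖ ^ 2 ≤ ‖z - γ • q - w‖ ^ 2 :=
        pow_le_pow_left₀ (norm_nonneg _) (h.norm_sub_le hK hw) 2
    _ = ‖z - w‖ ^ 2 + ‖γ • q‖ ^ 2 + 2 * γ * -inner ℝ (z - w) q := by
        rw [sub_right_comm, norm_sub_sq_real, inner_smul_right]
        ring
    _ ≤ ‖z - w‖ ^ 2 + L ^ 2 * γ ^ 2 + 2 * γ * (φ w - φ z) := by gcongr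

theorem norm_sum_smul_sub_sq_le {ι : Type*} [Fintype ι] {w : ι → ℝ} (hw : w ∈ stdSimplex ℝ ι)
    (z : ι → E) (a : E) :
    ‖(∑ j, w j • z j) - a‖ ^ 2 ≤ ∑ j, w j * ‖z j - a‖ ^ 2 := by
  have h_conv : ConvexOn ℝ Set.univ fun v : E => ‖v‖ ^ 2 :=
    (convexOn_norm convex_univ).pow (fun _ _ => norm_nonneg _) 2
  have h_center : (∑ j, w j • z j) - a = ∑ j, w j • (z j - a) := by
    simp only [smul_sub, Finset.sum_sub_distrib, ← Finset.sum_smul, hw.2, one_smul]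
  rw [h_center]
  exact h_conv.map_sum_le (fun j _ => hw.1 j) hw.2 fun j _ => Set.mem_univ _

end Projection

section Saddle

variable {E F : Type*} {X : Set E} {Y : Set F} {φ : E → F → ℝ} {a u : E} {b v : F}

/-- The gap `φ u b - φ a v` of the point `(u, v)` with respect to `(a, b)`. When `(a, b)` is a
saddle point, it measures how far `(u, v)` is from being one. -/
def saddleGap (φ : E → F → ℝ) (a : E) (b : F) (u : E) (v : F) : ℝ := φ u b - φ a v

theorem IsSaddle.saddleGap_nonneg (h : IsSaddle X Y φ a b) (hu : u ∈ X) (hv : v ∈ Y) :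
    0 ≤ saddleGap φ a b u v :=
  sub_nonneg.2 ((h.2.2.1 v hv).trans (h.2.2.2 u hu))

theorem IsSaddle.neg_swap (h : IsSaddle X Y φ a b) :
    IsSaddle Y X (fun y x => -φ x y) b a :=
  ⟨h.2.1, h.1, fun x hx => neg_le_neg (h.2.2.2 x hx), fun y hy => neg_le_neg (h.2.2.1 y hy)⟩

theorem IsSaddle.sum {ι : Type*} [Fintype ι] [Nonempty ι] {f : ι → E → F → ℝ}
    (h : ∀ i, IsSaddle X Y (f i) a b) : IsSaddle X Y (fun x y => ∑ i, f i x y) a b :=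
  have ⟨i⟩ := ‹Nonempty ι›
  ⟨(h i).1, (h i).2.1, fun v hv => Finset.sum_le_sum fun i _ => (h i).2.2.1 v hv,
    fun u hu => Finset.sum_le_sum fun i _ => (h i).2.2.2 u hu⟩

variable [NormedAddCommGroup E] [NormedSpace ℝ E] [NormedAddCommGroup F] [NormedSpace ℝ F]

theorem StrictlyConvexConcave.neg_swap (h : StrictlyConvexConcave φ) :
    StrictlyConvexConcave fun y x => -φ x y :=
  ⟨fun x => (h.2 x).neg, fun y => (h.1 y).neg⟩

theorem StrictlyConvexConcave.sum {ι : Type*} [Fintype ι] [Nonempty ι] {f : ι → E → F → ℝ}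
    (hf : ∀ i, StrictlyConvexConcave (f i)) :
    StrictlyConvexConcave fun x y => ∑ i, f i x y := by
  constructor
  · refine fun y => ⟨convex_univ, fun x hx x' hx' hxx' s t hs ht hst => ?_⟩
    simp only [smul_eq_mul, Finset.mul_sum, ← Finset.sum_add_distrib]
    exact Finset.sum_lt_sum_of_nonempty Finset.univ_nonempty
      fun i _ => ((hf i).1 y).2 hx hx' hxx' hs ht hst
  · refine fun x => ⟨convex_univ, fun y hy y' hy' hyy' s t hs ht hst => ?_⟩
    simp only [smul_eq_mul, Finset.mul_sum, ← Finset.sum_add_distrib]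
    exact Finset.sum_lt_sum_of_nonempty Finset.univ_nonempty
      fun i _ => ((hf i).2 x).2 hy hy' hyy' hs ht hst

theorem StrictlyConvexConcave.continuous_left [FiniteDimensional ℝ E]
    (h : StrictlyConvexConcave φ) (v : F) : Continuous fun u => φ u v :=
  (h.1 v).convexOn.locallyLipschitz.continuous

theorem StrictlyConvexConcave.continuous_right [FiniteDimensional ℝ F]
    (h : StrictlyConvexConcave φ) (u : E) : Continuous (φ u) :=
  (h.2 u).concaveOn.locallyLipschitz.continuous

theorem IsSaddle.apply_lt_left (hX : Convex ℝ X) (hφ : StrictlyConvexConcave φ)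
    (h : IsSaddle X Y φ a b) (hu : u ∈ X) (hne : u ≠ a) : φ a b < φ u b :=
  (h.2.2.2 u hu).lt_of_ne fun heq =>
    hne (((hφ.1 b).subset (Set.subset_univ X) hX).eq_of_isMinOn
      (fun w hw => heq.ge.trans (h.2.2.2 w hw)) h.2.2.2 hu h.1)

theorem IsSaddle.saddleGap_pos (hX : Convex ℝ X) (hY : Convex ℝ Y)
    (hφ : StrictlyConvexConcave φ) (h : IsSaddle X Y φ a b) (hu : u ∈ X) (hv : v ∈ Y)
    (hne : (u, v) ≠ (a, b)) : 0 < saddleGap φ a b u v := by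
  rcases ne_or_eq u a with hua | rfl
  · exact sub_pos.2 ((h.2.2.1 v hv).trans_lt (h.apply_lt_left hX hφ hu hua))
  · have hvb : v ≠ b := fun hvb => hne (hvb ▸ rfl)
    exact sub_pos.2 (neg_lt_neg_iff.1 (h.neg_swap.apply_lt_left hY hφ.neg_swap hv hvb))

theorem IsSaddle.unique (hX : Convex ℝ X) (hY : Convex ℝ Y) (hφ : StrictlyConvexConcave φ)
    (h : IsSaddle X Y φ a b) (h' : IsSaddle X Y φ u v) : (u, v) = (a, b) := by
  by_contra hne
  have h_pos := h.saddleGap_pos hX hY hφ h'.1 h'.2.1 hne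
  have h_nonneg := h'.saddleGap_nonneg h.1 h.2.1
  exact h_pos.not_ge (by simpa only [saddleGap, neg_sub, Left.neg_nonpos_iff, sub_nonneg,
    sub_nonpos] using h_nonneg)

theorem exists_pos_forall_le_saddleGap [FiniteDimensional ℝ E] [FiniteDimensional ℝ F]
    {ι : Type*} [Finite ι] {f : ι → E → F → ℝ} (hX : Convex ℝ X) (hY : Convex ℝ Y)
    (hf : ∀ i, StrictlyConvexConcave (f i)) (h : ∀ i, IsSaddle X Y (f i) a b)
    {K : Set (E × F)} (hK : IsCompact K) (hK_sub : K ⊆ X ×ˢ Y) (hK_notMem : (a, b) ∉ K) :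
    ∃ c > 0, ∀ p ∈ K, ∀ i, c ≤ saddleGap (f i) a b p.1 p.2 := by
  have eventually_le : ∀ᶠ c in 𝓝[>] (0 : ℝ), ∀ i, ∀ p ∈ K, c ≤ saddleGap (f i) a b p.1 p.2 := by
    refine eventually_all.2 fun i => ?_
    have h_cont : Continuous fun p : E × F => saddleGap (f i) a b p.1 p.2 :=
      (((hf i).continuous_left b).comp continuous_fst).sub
        (((hf i).continuous_right a).comp continuous_snd)
    obtain ⟨c₀, hc₀, hc₀_le⟩ := hK.exists_forall_le' h_cont.continuousOn fun p hp =>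
      (h i).saddleGap_pos hX hY (hf i) (hK_sub hp).1 (hK_sub hp).2
        fun hp_eq => hK_notMem (hp_eq ▸ hp)
    filter_upwards [Ioo_mem_nhdsGT hc₀] with c hc p hp
    exact hc.2.le.trans (hc₀_le p hp)
  obtain ⟨c, hc_le, hc⟩ := (eventually_le.and self_mem_nhdsWithin).exists
  exact ⟨c, hc, fun p hp i => hc_le i p hp⟩

theorem exists_pos_forall_annulus_le_saddleGap [FiniteDimensional ℝ E] [FiniteDimensional ℝ F]
    {ι : Type*} [Finite ι] {f : ι → E → F → ℝ} (hXc : IsClosed X) (hX : Convex ℝ X)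
    (hYc : IsClosed Y) (hY : Convex ℝ Y) (hf : ∀ i, StrictlyConvexConcave (f i))
    (h : ∀ i, IsSaddle X Y (f i) a b) {r : ℝ} (hr : 0 < r) (R : ℝ) :
    ∃ c > 0, ∀ u ∈ X, ∀ v ∈ Y, r ≤ ‖WithLp.toLp 2 (u, v) - WithLp.toLp 2 (a, b)‖ →
      ‖WithLp.toLp 2 (u, v) - WithLp.toLp 2 (a, b)‖ ≤ R → ∀ i, c ≤ saddleGap (f i) a b u v := by
  have : ProperSpace (WithLp 2 (E × F)) := FiniteDimensional.proper ℝ _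
  let annulus := Metric.closedBall (WithLp.toLp 2 (a, b)) R \ Metric.ball (WithLp.toLp 2 (a, b)) r
  have annulus_compact : IsCompact ((WithLp.homeomorphProd 2 E F).symm ⁻¹' annulus) :=
    (WithLp.homeomorphProd 2 E F).symm.isCompact_preimage.2
      ((isCompact_closedBall _ R).diff Metric.isOpen_ball)
  obtain ⟨c, hc, hc_le⟩ := exists_pos_forall_le_saddleGap hX hY hf h
    (annulus_compact.inter_left (hXc.prod hYc)) Set.inter_subset_left
    fun hab => hab.2.2 (Metric.mem_ball_self hr)
  refine ⟨c, hc, fun u hu v hv hr_le hR_le => hc_le (u, v) ⟨⟨hu, hv⟩, ?_, ?_⟩⟩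
  · exact mem_closedBall_iff_norm.2 hR_le
  · exact fun hmem => (mem_ball_iff_norm.1 hmem).not_ge hr_le

end Saddle

section JointState

open scoped Matrix.Module

variable {E F : Type*} [NormedAddCommGroup E] [NormedAddCommGroup F] {n : ℕ}

/-- The states of the pairs of agents, as points of the Euclidean product of the two spaces. -/
def jointState (x : Fin n → E) (y : Fin n → F) : Fin n → WithLp 2 (E × F) :=
  fun i => WithLp.toLp 2 (x i, y i)

theorem norm_toLp_sub_toLp_sq (u a : E) (v b : F) :
    ‖WithLp.toLp 2 (u, v) - WithLp.toLp 2 (a, b)‖ ^ 2 = ‖u - a‖ ^ 2 + ‖v - b‖ ^ 2 :=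
  WithLp.prod_norm_sq_eq_of_L2 _

theorem disagreement_le_jointState_left (x : Fin n → E) (y : Fin n → F) :
    disagreement x ≤ disagreement (jointState x y) :=
  disagreement_le (disagreement_nonneg _) fun i j =>
    (WithLp.norm_fst_le E (jointState x y i - jointState x y j)).trans
      (norm_sub_le_disagreement _ i j)

theorem disagreement_le_jointState_right (x : Fin n → E) (y : Fin n → F) :
    disagreement y ≤ disagreement (jointState x y) :=
  disagreement_le (disagreement_nonneg _) fun i j =>
    (WithLp.norm_snd_le E (jointState x y i - jointState x y j)).trans
      (norm_sub_le_disagreement _ i j)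

theorem smul_jointState [NormedSpace ℝ E] [NormedSpace ℝ F] (A : Matrix (Fin n) (Fin n) ℝ)
    (x : Fin n → E) (y : Fin n → F) :
    A • jointState x y = jointState (A • x) (A • y) := by
  ext i : 1
  simp only [Matrix.Module.smul_apply, jointState, ← WithLp.toLp_smul, ← WithLp.toLp_sum,
    Prod.smul_mk, prod_mk_sum]

end JointState

section Trajectory

open scoped Matrix.Module

variable {E F : Type*} [NormedAddCommGroup E] [InnerProductSpace ℝ E]
  [NormedAddCommGroup F] [InnerProductSpace ℝ F] {n : ℕ} {X : Set E} {Y : Set F}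
  {f : Fin n → E → F → ℝ} {G : ℕ → WeightedDigraph n} {γ : ℕ → ℝ}
  {x : ℕ → Fin n → E} {y : ℕ → Fin n → F} {L : ℝ}

/-- `L` bounds the norms of the subgradients of all `f i` at all points of `X × Y`: the condition on
the constant in `BoundedSubgradients`. -/
def SubgradientBound (X : Set E) (Y : Set F) (f : Fin n → E → F → ℝ) (L : ℝ) : Prop :=
  ∀ i, ∀ x ∈ X, ∀ y ∈ Y,
    (∀ q ∈ subdiffConvex (fun x' => f i x' y) x, ‖q‖ ≤ L) ∧
      ∀ q ∈ subdiffConcave (fun y' => f i x y') y, ‖q‖ ≤ L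

theorem SubgradientBound.neg_swap (hL : SubgradientBound X Y f L) :
    SubgradientBound Y X (fun i y x => -f i x y) L := by
  refine fun i y hy x hx => ⟨fun q hq => ?_, fun q hq => ?_⟩
  · rw [← norm_neg]
    refine (hL i x hx y hy).2 _ (mem_subdiffConcave_iff_neg_mem.2 ?_)
    rwa [neg_neg]
  · rw [← norm_neg]
    refine (hL i x hx y hy).1 _ ?_
    simpa using mem_subdiffConcave_iff_neg_mem.1 hq

theorem SubgradientBound.sub_le [FiniteDimensional ℝ E] (hL : SubgradientBound X Y f L)
    (hf : ∀ i, StrictlyConvexConcave (f i)) {u w : E} {v : F} (hu : u ∈ X) (hv : v ∈ Y)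
    (i : Fin n) : f i u v - f i w v ≤ L * ‖u - w‖ := by
  obtain ⟨q, hq⟩ := subdiffConvex_nonempty ((hf i).1 v).convexOn u
  exact sub_le_of_mem_subdiffConvex hq ((hL i u hu v hv).1 q hq)

theorem IsTrajectory.neg_swap (h : IsTrajectory X Y f G γ x y) :
    IsTrajectory Y X (fun i y x => -f i x y) G γ y x := by
  intro k i
  obtain ⟨⟨q, hq, hp⟩, r, hr, hs⟩ := h k i
  refine ⟨⟨-r, mem_subdiffConcave_iff_neg_mem.1 hr, ?_⟩, -q,
    mem_subdiffConcave_iff_neg_mem.2 ?_, ?_⟩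
  · rwa [smul_neg, sub_neg_eq_add]
  · simpa using hq
  · rwa [smul_neg, ← sub_eq_add_neg]

theorem IsTrajectory.succ_mem (h : IsTrajectory X Y f G γ x y) (k : ℕ) (i : Fin n) :
    x (k + 1) i ∈ X ∧ y (k + 1) i ∈ Y :=
  have ⟨⟨_, _, hx⟩, _, _, hy⟩ := h k i
  ⟨hx.1, hy.1⟩

theorem IsTrajectory.norm_sub_smul_apply_le (hX : Convex ℝ X) (hL : SubgradientBound X Y f L)
    (hG : WeightRule G) (h : IsTrajectory X Y f G γ x y) {k : ℕ} (hγ : 0 ≤ γ k)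
    (hx : ∀ i, x k i ∈ X) (hy : ∀ i, y k i ∈ Y) (i : Fin n) :
    ‖x (k + 1) i - ((G k).weight • x k) i‖ ≤ L * γ k := by
  obtain ⟨⟨q, hq, hp⟩, -⟩ := h k i
  have hz := smul_apply_mem_of_mem_rowStochastic (hG.weight_mem_rowStochastic k) hX hx i
  exact hp.norm_sub_le_of_step hX hγ ((hL i _ hz _ (hy i)).1 q hq) hz

theorem IsTrajectory.norm_sub_sq_le (hX : Convex ℝ X) (hL : SubgradientBound X Y f L)
    (hG : WeightRule G) (h : IsTrajectory X Y f G γ x y) {k : ℕ} (hγ : 0 ≤ γ k)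
    (hx : ∀ i, x k i ∈ X) (hy : ∀ i, y k i ∈ Y) {w : E} (hw : w ∈ X) (i : Fin n) :
    ‖x (k + 1) i - w‖ ^ 2 ≤ ‖((G k).weight • x k) i - w‖ ^ 2 + L ^ 2 * γ k ^ 2
      + 2 * γ k * (f i w (y k i) - f i (((G k).weight • x k) i) (y k i)) := by
  obtain ⟨⟨q, hq, hp⟩, -⟩ := h k i
  have hz := smul_apply_mem_of_mem_rowStochastic (hG.weight_mem_rowStochastic k) hX hx i
  exact hp.norm_sub_sq_le_of_step hX hγ hq ((hL i _ hz _ (hy i)).1 q hq) hw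

theorem IsTrajectory.norm_jointState_sub_smul_le [Nonempty (Fin n)] (hX : Convex ℝ X)
    (hY : Convex ℝ Y) (hL : SubgradientBound X Y f L) (hG : WeightRule G)
    (h : IsTrajectory X Y f G γ x y) {k : ℕ} (hγ : 0 ≤ γ k)
    (hx : ∀ i, x k i ∈ X) (hy : ∀ i, y k i ∈ Y) :
    ‖jointState (x (k + 1)) (y (k + 1)) - (G k).weight • jointState (x k) (y k)‖
      ≤ 2 * (L * γ k) := by
  refine (pi_norm_le_iff_of_nonempty _).2 fun i => ?_
  rw [smul_jointState]
  have hx_le := h.norm_sub_smul_apply_le hX hL hG hγ hx hy i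
  have hy_le := h.neg_swap.norm_sub_smul_apply_le hY hL.neg_swap hG hγ hy hx i
  have h_nonneg : 0 ≤ L * γ k := (norm_nonneg _).trans hx_le
  refine le_of_sq_le_sq ?_ (mul_nonneg zero_le_two h_nonneg)
  calc ‖jointState (x (k + 1)) (y (k + 1)) i
        - jointState ((G k).weight • x k) ((G k).weight • y k) i‖ ^ 2
      = ‖x (k + 1) i - ((G k).weight • x k) i‖ ^ 2
        + ‖y (k + 1) i - ((G k).weight • y k) i‖ ^ 2 := norm_toLp_sub_toLp_sq _ _ _ _
    _ ≤ (L * γ k) ^ 2 + (L * γ k) ^ 2 := by gcongr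
    _ ≤ (2 * (L * γ k)) ^ 2 := by linarith [sq_nonneg (L * γ k)]

theorem IsTrajectory.norm_sub_sq_le_add_disagreement [FiniteDimensional ℝ E] (hX : Convex ℝ X)
    (hf : ∀ i, StrictlyConvexConcave (f i)) (hL_nonneg : 0 ≤ L) (hL : SubgradientBound X Y f L)
    (hG : WeightRule G) (h : IsTrajectory X Y f G γ x y) {k : ℕ} (hγ : 0 ≤ γ k)
    (hx : ∀ i, x k i ∈ X) (hy : ∀ i, y k i ∈ Y) {w : E} (hw : w ∈ X) (i : Fin n) :
    ‖x (k + 1) i - w‖ ^ 2 ≤ ‖((G k).weight • x k) i - w‖ ^ 2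
      + (L ^ 2 * γ k ^ 2 + L * (γ k ^ 2 + disagreement (x k) ^ 2))
      - 2 * γ k * (f i (x k i) (y k i) - f i w (y k i)) := by
  have h_lipschitz : f i (x k i) (y k i) - f i (((G k).weight • x k) i) (y k i)
      ≤ L * disagreement (x k) := by
    refine (hL.sub_le hf (hx i) (hy i) i).trans (mul_le_mul_of_nonneg_left ?_ hL_nonneg)
    rw [norm_sub_rev]
    exact norm_smul_apply_sub_le_disagreement (hG.weight_mem_rowStochastic k) _ i i
  have h_error := mul_le_mul_of_nonneg_left h_lipschitz hγ
  have h_amgm := mul_le_mul_of_nonneg_left (two_mul_le_add_sq (γ k) (disagreement (x k))) hL_nonneg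
  linarith [h.norm_sub_sq_le hX hL hG hγ hx hy hw i]

theorem IsTrajectory.norm_jointState_sub_sq_le [FiniteDimensional ℝ E] [FiniteDimensional ℝ F]
    (hX : Convex ℝ X) (hY : Convex ℝ Y) (hf : ∀ i, StrictlyConvexConcave (f i))
    (hL_nonneg : 0 ≤ L) (hL : SubgradientBound X Y f L) (hG : WeightRule G)
    (h : IsTrajectory X Y f G γ x y) {k : ℕ} (hγ : 0 ≤ γ k)
    (hx : ∀ i, x k i ∈ X) (hy : ∀ i, y k i ∈ Y) {a : E} {b : F} (ha : a ∈ X) (hb : b ∈ Y)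
    (i : Fin n) :
    ‖jointState (x (k + 1)) (y (k + 1)) i - WithLp.toLp 2 (a, b)‖ ^ 2
      ≤ ‖jointState (x k) (y k) - Function.const _ (WithLp.toLp 2 (a, b))‖ ^ 2
        + 2 * (L ^ 2 * γ k ^ 2 + L * (γ k ^ 2 + disagreement (jointState (x k) (y k)) ^ 2))
        - 2 * γ k * saddleGap (f i) a b (x k i) (y k i) := by
  have hx_le := h.norm_sub_sq_le_add_disagreement hX hf hL_nonneg hL hG hγ hx hy ha i
  have hy_le := h.neg_swap.norm_sub_sq_le_add_disagreement hY (fun i => (hf i).neg_swap) hL_nonneg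
    hL.neg_swap hG hγ hy hx hb i
  have h_average : ‖((G k).weight • x k) i - a‖ ^ 2 + ‖((G k).weight • y k) i - b‖ ^ 2
      ≤ ‖jointState (x k) (y k) - Function.const _ (WithLp.toLp 2 (a, b))‖ ^ 2 := by
    have := norm_smul_apply_sub_le (hG.weight_mem_rowStochastic k) (jointState (x k) (y k))
      (WithLp.toLp 2 (a, b)) i
    rw [smul_jointState] at this
    exact (norm_toLp_sub_toLp_sq _ _ _ _).symm.trans_le (pow_le_pow_left₀ (norm_nonneg _) this 2)
  have hx_dis := mul_le_mul_of_nonneg_left (pow_le_pow_left₀ (disagreement_nonneg _)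
    (disagreement_le_jointState_left (x k) (y k)) 2) hL_nonneg
  have hy_dis := mul_le_mul_of_nonneg_left (pow_le_pow_left₀ (disagreement_nonneg _)
    (disagreement_le_jointState_right (x k) (y k)) 2) hL_nonneg
  rw [jointState, norm_toLp_sub_toLp_sq, saddleGap]
  linarith

theorem IsTrajectory.norm_jointState_sub_const_sq_le [Nonempty (Fin n)] [FiniteDimensional ℝ E]
    [FiniteDimensional ℝ F] (hX : Convex ℝ X) (hY : Convex ℝ Y)
    (hf : ∀ i, StrictlyConvexConcave (f i)) (hL_nonneg : 0 ≤ L) (hL : SubgradientBound X Y f L)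
    (hG : WeightRule G) (h : IsTrajectory X Y f G γ x y) {k : ℕ} (hγ : 0 ≤ γ k)
    (hx : ∀ i, x k i ∈ X) (hy : ∀ i, y k i ∈ Y) {a : E} {b : F} (ha : a ∈ X) (hb : b ∈ Y)
    {c : ℝ} (hc : ∀ i, c ≤ saddleGap (f i) a b (x k i) (y k i)) :
    ‖jointState (x (k + 1)) (y (k + 1)) - Function.const _ (WithLp.toLp 2 (a, b))‖ ^ 2
        + 2 * c * γ k
      ≤ ‖jointState (x k) (y k) - Function.const _ (WithLp.toLp 2 (a, b))‖ ^ 2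
        + 2 * (L ^ 2 * γ k ^ 2
          + L * (γ k ^ 2 + disagreement (jointState (x k) (y k)) ^ 2)) := by
  obtain ⟨i, hi⟩ := exists_norm_apply_eq_norm
    (jointState (x (k + 1)) (y (k + 1)) - Function.const _ (WithLp.toLp 2 (a, b)))
  rw [← hi, Pi.sub_apply, Function.const_apply]
  have h_gap := mul_le_mul_of_nonneg_left (hc i) (mul_nonneg zero_le_two hγ)
  linarith [h.norm_jointState_sub_sq_le hX hY hf hL_nonneg hL hG hγ hx hy ha hb i]

theorem IsTrajectory.summable_disagreement_jointState_sq [Nonempty (Fin n)] (hX : Convex ℝ X)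
    (hY : Convex ℝ Y) (hL : SubgradientBound X Y f L) (hU : UJSC G) (hG : WeightRule G)
    (hγ : ∀ k, 0 ≤ γ k) (hγ_sq : Summable fun k => γ k ^ 2) (h : IsTrajectory X Y f G γ x y)
    (hx : ∀ k i, x k i ∈ X) (hy : ∀ k i, y k i ∈ Y) :
    Summable fun k => disagreement (jointState (x k) (y k)) ^ 2 := by
  refine hU.summable_disagreement_sq hG (e := fun k => 2 * (L * γ k)) ?_ fun k =>
    h.norm_jointState_sub_smul_le hX hY hL hG (hγ k) (hx k) (hy k)
  simpa only [mul_pow] using (hγ_sq.mul_left (L ^ 2)).mul_left (2 ^ 2)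

theorem IsTrajectory.tendsto_norm_jointState_sub_sq [Nonempty (Fin n)] [FiniteDimensional ℝ E]
    [FiniteDimensional ℝ F] (hXc : IsClosed X) (hX : Convex ℝ X) (hYc : IsClosed Y)
    (hY : Convex ℝ Y) (hf : ∀ i, StrictlyConvexConcave (f i)) (hL_nonneg : 0 ≤ L)
    (hL : SubgradientBound X Y f L) (hU : UJSC G) (hG : WeightRule G) (hγ : ∀ k, 0 ≤ γ k)
    (hγ_div : ¬ Summable γ) (hγ_sq : Summable fun k => γ k ^ 2)
    (h : IsTrajectory X Y f G γ x y) (hx : ∀ k i, x k i ∈ X) (hy : ∀ k i, y k i ∈ Y)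
    {a : E} {b : F} (hab : ∀ i, IsSaddle X Y (f i) a b) :
    Tendsto (fun k => ‖jointState (x k) (y k) - Function.const _ (WithLp.toLp 2 (a, b))‖ ^ 2)
      atTop (𝓝 0) := by
  set p := fun k => jointState (x k) (y k)
  set s := WithLp.toLp 2 (a, b)
  have ⟨i₀⟩ := ‹Nonempty (Fin n)›
  have h_dis := h.summable_disagreement_jointState_sq hX hY hL hU hG hγ hγ_sq hx hy
  have h_dis_tendsto : Tendsto (fun k => disagreement (p k)) atTop (𝓝 0) := by
    simpa [Real.sqrt_sq (disagreement_nonneg _)] using h_dis.tendsto_atTop_zero.sqrt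
  have hε := ((hγ_sq.mul_left (L ^ 2)).add ((hγ_sq.add h_dis).mul_left L)).mul_left 2
  have h_step := fun k c hc => h.norm_jointState_sub_const_sq_le hX hY hf hL_nonneg hL hG (hγ k)
    (hx k) (hy k) (hab i₀).1 (hab i₀).2.1 (c := c) hc
  have h_succ := fun k => by
    simpa using h_step k 0 fun i => (hab i).saddleGap_nonneg (hx k i) (hy k i)
  refine tendsto_zero_of_descent (fun k => sq_nonneg _) hε hγ hγ_div h_succ fun r hr => ?_
  obtain ⟨ξ, hξ⟩ := exists_tendsto_of_le_add (M := fun k => ‖p k - Function.const _ s‖ ^ 2)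
    (fun k => sq_nonneg _) hε h_succ
  obtain ⟨R, hR⟩ := hξ.bddAbove_range
  have hr_sqrt := half_pos (Real.sqrt_pos.2 hr)
  obtain ⟨c, hc, hc_le⟩ :=
    exists_pos_forall_annulus_le_saddleGap hXc hX hYc hY hf hab hr_sqrt (√R)
  refine ⟨2 * c, by positivity, ?_⟩
  filter_upwards [h_dis_tendsto.eventually_lt_const hr_sqrt] with k hk hrk
  refine h_step k c fun i => hc_le _ (hx k i) _ (hy k i) ?_ ?_ i
  · have h_far : √r ≤ ‖p k - Function.const _ s‖ := (Real.sqrt_le_left (norm_nonneg _)).2 hrk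
    have := norm_sub_const_le_add_disagreement (p k) s i
    change _ ≤ ‖p k i - s‖
    linarith
  · exact (norm_le_pi_norm (p k - Function.const _ s) i).trans (Real.le_sqrt_of_sq_le (hR ⟨k, rfl⟩))

theorem IsTrajectory.tendsto_of_forall_mem [Nonempty (Fin n)] [FiniteDimensional ℝ E]
    [FiniteDimensional ℝ F] (hXc : IsClosed X) (hX : Convex ℝ X) (hYc : IsClosed Y)
    (hY : Convex ℝ Y) (hf : ∀ i, StrictlyConvexConcave (f i)) (hL_nonneg : 0 ≤ L)
    (hL : SubgradientBound X Y f L) (hU : UJSC G) (hG : WeightRule G) (hγ : ∀ k, 0 ≤ γ k)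
    (hγ_div : ¬ Summable γ) (hγ_sq : Summable fun k => γ k ^ 2)
    (h : IsTrajectory X Y f G γ x y) (hx : ∀ k i, x k i ∈ X) (hy : ∀ k i, y k i ∈ Y)
    {a : E} {b : F} (hab : ∀ i, IsSaddle X Y (f i) a b) (i : Fin n) :
    Tendsto (fun k => x k i) atTop (𝓝 a) ∧ Tendsto (fun k => y k i) atTop (𝓝 b) := by
  have h_sq := h.tendsto_norm_jointState_sub_sq hXc hX hYc hY hf hL_nonneg hL hU hG hγ hγ_div
    hγ_sq hx hy hab
  have h_state : Tendsto (fun k => jointState (x k) (y k)) atTop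
      (𝓝 (Function.const _ (WithLp.toLp 2 (a, b)))) := by
    refine tendsto_iff_norm_sub_tendsto_zero.2 ?_
    simpa [Real.sqrt_sq (norm_nonneg _)] using h_sq.sqrt
  have h_pair := tendsto_pi_nhds.1 h_state i
  exact ⟨((WithLp.continuous_fst 2 E F).tendsto _).comp h_pair,
    ((WithLp.continuous_snd 2 E F).tendsto _).comp h_pair⟩

theorem UJSC.shift (h : UJSC G) : UJSC fun k => G (k + 1) := by
  obtain ⟨T, hT, h⟩ := h
  refine ⟨T, hT, fun k i j => Relation.ReflTransGen.mono ?_ i j (h (k + 1) i j)⟩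
  rintro u v ⟨s, hs_ge, hs_lt, harc⟩
  obtain ⟨s, rfl⟩ := Nat.exists_eq_add_of_le' (Nat.le_of_add_left_le hs_ge)
  exact ⟨s, by lia, by lia, harc⟩

theorem WeightRule.shift (h : WeightRule G) : WeightRule fun k => G (k + 1) :=
  have ⟨⟨η, hη_pos, hη_lt, hη⟩, h_sum⟩ := h
  ⟨⟨η, hη_pos, hη_lt, fun k => hη (k + 1)⟩, fun k => h_sum (k + 1)⟩

theorem achievesNash_of_forall_isSaddle [Nonempty (Fin n)] [FiniteDimensional ℝ E]
    [FiniteDimensional ℝ F] (hXc : IsClosed X) (hX : Convex ℝ X) (hYc : IsClosed Y)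
    (hY : Convex ℝ Y) (hf : ∀ i, StrictlyConvexConcave (f i))
    (hbounded : BoundedSubgradients X Y f) (hU : UJSC G) (hG : WeightRule G)
    (hγ : ∀ k, 0 ≤ γ k) (hγ_div : ¬ Summable γ) (hγ_sq : Summable fun k => γ k ^ 2)
    {a : E} {b : F} (hab : ∀ i, IsSaddle X Y (f i) a b) : AchievesNash X Y f G γ := by
  obtain ⟨L, hL_pos, hL⟩ := hbounded
  intro x y h
  have h_tendsto := IsTrajectory.tendsto_of_forall_mem (x := fun k => x (k + 1))
    (y := fun k => y (k + 1)) hXc hX hYc hY hf hL_pos.le hL hU.shift hG.shift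
    (fun k => hγ (k + 1)) (mt (summable_nat_add_iff 1).1 hγ_div) ((summable_nat_add_iff 1).2 hγ_sq)
    (fun k => h (k + 1)) (fun k i => (h.succ_mem k i).1) (fun k i => (h.succ_mem k i).2) hab
  exact ⟨a, b, IsSaddle.sum hab, fun i => (tendsto_add_atTop_iff_nat 1).1 (h_tendsto i).1,
    fun i => (tendsto_add_atTop_iff_nat 1).1 (h_tendsto i).2⟩

end Trajectory

section Necessity

open scoped Matrix.Module

theorem exists_mem_subdiffConvex_isProj {E : Type*} [NormedAddCommGroup E] [InnerProductSpace ℝ E]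
    [FiniteDimensional ℝ E] {K : Set E} (hne : K.Nonempty) (hKc : IsClosed K) (hK : Convex ℝ K)
    {φ : E → ℝ} (hφ : ConvexOn ℝ Set.univ φ) (z : E) (γ : ℝ) :
    ∃ p, ∃ q ∈ subdiffConvex φ z, IsProj K (z - γ • q) p := by
  have : CompleteSpace E := FiniteDimensional.complete ℝ E
  obtain ⟨q, hq⟩ := subdiffConvex_nonempty hφ z
  obtain ⟨p, hp⟩ :=
    exists_norm_eq_iInf_of_complete_convex hne hKc.isComplete hK (z - γ • q)
  exact ⟨p, q, hq, hp⟩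

theorem exists_mem_subdiffConcave_isProj {E : Type*} [NormedAddCommGroup E] [InnerProductSpace ℝ E]
    [FiniteDimensional ℝ E] {K : Set E} (hne : K.Nonempty) (hKc : IsClosed K) (hK : Convex ℝ K)
    {φ : E → ℝ} (hφ : ConcaveOn ℝ Set.univ φ) (z : E) (γ : ℝ) :
    ∃ p, ∃ q ∈ subdiffConcave φ z, IsProj K (z + γ • q) p := by
  obtain ⟨p, q, hq, hp⟩ := exists_mem_subdiffConvex_isProj hne hKc hK hφ.neg z γ
  refine ⟨p, -q, mem_subdiffConcave_iff_neg_mem.2 ((neg_neg q).symm ▸ hq), ?_⟩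
  rwa [smul_neg, ← sub_eq_add_neg]

variable {E F : Type*} [NormedAddCommGroup E] [InnerProductSpace ℝ E]
  [NormedAddCommGroup F] [InnerProductSpace ℝ F] {n : ℕ}
  {X : Set E} {Y : Set F} {f : Fin n → E → F → ℝ} {γ : ℕ → ℝ} {L : ℝ}

theorem exists_isTrajectory [FiniteDimensional ℝ E] [FiniteDimensional ℝ F] (hXne : X.Nonempty)
    (hXc : IsClosed X) (hX : Convex ℝ X) (hYne : Y.Nonempty) (hYc : IsClosed Y) (hY : Convex ℝ Y)
    (hf : ∀ i, StrictlyConvexConcave (f i)) (G : ℕ → WeightedDigraph n) (γ : ℕ → ℝ)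
    (x₀ : Fin n → E) (y₀ : Fin n → F) :
    ∃ x y, IsTrajectory X Y f G γ x y ∧ x 0 = x₀ ∧ y 0 = y₀ := by
  choose next_x h_next_x using fun k (s : (Fin n → E) × (Fin n → F)) i =>
    exists_mem_subdiffConvex_isProj hXne hXc hX ((hf i).1 (s.2 i)).convexOn
      (∑ j, (G k).weight i j • s.1 j) (γ k)
  choose next_y h_next_y using fun k (s : (Fin n → E) × (Fin n → F)) i =>
    exists_mem_subdiffConcave_isProj hYne hYc hY ((hf i).2 (s.1 i)).concaveOn
      (∑ j, (G k).weight i j • s.2 j) (γ k)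
  let s : ℕ → (Fin n → E) × (Fin n → F) :=
    Nat.rec (x₀, y₀) fun k s => (next_x k s, next_y k s)
  exact ⟨fun k => (s k).1, fun k => (s k).2,
    fun k i => ⟨h_next_x k (s k) i, h_next_y k (s k) i⟩, rfl, rfl⟩

/-- The complete digraph in which every node gives the weight `μ j` to the state of the node `j`.
A single averaging step along it leads to consensus on the `μ`-average. -/
def WeightedDigraph.ofVector (μ : Fin n → ℝ) (hμ : ∀ i, 0 < μ i) : WeightedDigraph n where
  weight := Matrix.of fun _ j => μ j
  weight_nonneg _ _ := (hμ _).le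
  self_loop i := hμ i

theorem uJSC_ofVector {μ : Fin n → ℝ} (hμ : ∀ i, 0 < μ i) :
    UJSC fun _ => WeightedDigraph.ofVector μ hμ :=
  ⟨1, one_pos, fun k i _ => Relation.ReflTransGen.single ⟨k, le_rfl, Nat.lt_succ_self k, hμ i⟩⟩

theorem weightRule_ofVector {μ : Fin n → ℝ} (hμ : ∀ i, 0 < μ i) (hμ_sum : ∑ i, μ i = 1) :
    WeightRule fun _ => WeightedDigraph.ofVector μ hμ := by
  have h_lower : ∀ᶠ η in 𝓝[>] (0 : ℝ), ∀ j, η ∈ Set.Ioo 0 (μ j) :=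
    eventually_all.2 fun j => Ioo_mem_nhdsGT (hμ j)
  obtain ⟨η, hη, hη_lt⟩ := (h_lower.and (Ioo_mem_nhdsGT one_pos)).exists
  exact ⟨⟨η, hη_lt.1, hη_lt.2, fun _ _ j _ => (hη j).2.le⟩, fun _ _ => hμ_sum⟩

theorem SubgradientBound.tendsto_apply [FiniteDimensional ℝ E] [FiniteDimensional ℝ F]
    (hL : SubgradientBound X Y f L) (hf : ∀ i, StrictlyConvexConcave (f i)) {u : ℕ → E}
    {v : ℕ → F} {a : E} {b : F} (hu : ∀ k, u k ∈ X) (ha : a ∈ X) (hv : ∀ k, v k ∈ Y)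
    (hua : Tendsto u atTop (𝓝 a)) (hvb : Tendsto v atTop (𝓝 b)) (i : Fin n) :
    Tendsto (fun k => f i (u k) (v k)) atTop (𝓝 (f i a b)) := by
  have h_right : Tendsto (fun k => f i a (v k)) atTop (𝓝 (f i a b)) :=
    (((hf i).continuous_right a).tendsto b).comp hvb
  have h_diff : Tendsto (fun k => f i (u k) (v k) - f i a (v k)) atTop (𝓝 0) := by
    refine squeeze_zero_norm (a := fun k => L * ‖u k - a‖)
      (fun k => abs_sub_le_iff.2 ⟨hL.sub_le hf (hu k) (hv k) i, ?_⟩) ?_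
    · exact norm_sub_rev a (u k) ▸ hL.sub_le hf ha (hv k) i
    · simpa using (tendsto_iff_norm_sub_tendsto_zero.1 hua).const_mul L
  simpa using h_diff.add h_right

theorem IsTrajectory.sum_mul_norm_sub_sq_le (hX : Convex ℝ X) (hL : SubgradientBound X Y f L)
    {μ : Fin n → ℝ} (hμ : ∀ i, 0 < μ i) (hμ_sum : ∑ i, μ i = 1) {x : ℕ → Fin n → E}
    {y : ℕ → Fin n → F} (h : IsTrajectory X Y f (fun _ => WeightedDigraph.ofVector μ hμ) γ x y)
    {k : ℕ} (hγ : 0 ≤ γ k) (hx : ∀ i, x k i ∈ X) (hy : ∀ i, y k i ∈ Y) {w : E} (hw : w ∈ X) :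
    ∑ i, μ i * ‖x (k + 1) i - w‖ ^ 2 ≤ ∑ i, μ i * ‖x k i - w‖ ^ 2 + L ^ 2 * γ k ^ 2
      + 2 * γ k * ∑ i, μ i * (f i w (y k i) - f i (∑ j, μ j • x k j) (y k i)) := by
  calc ∑ i, μ i * ‖x (k + 1) i - w‖ ^ 2
      ≤ ∑ i, μ i * (∑ j, μ j * ‖x k j - w‖ ^ 2 + L ^ 2 * γ k ^ 2
          + 2 * γ k * (f i w (y k i) - f i (∑ j, μ j • x k j) (y k i))) := by
        refine Finset.sum_le_sum fun i _ => mul_le_mul_of_nonneg_left ?_ (hμ i).le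
        refine (h.norm_sub_sq_le hX hL (weightRule_ofVector hμ hμ_sum) hγ hx hy hw i).trans ?_
        exact add_le_add_left (add_le_add_left
          (norm_sum_smul_sub_sq_le ⟨fun j => (hμ j).le, hμ_sum⟩ (x k) w) _) _
    _ = _ := by
        simp only [mul_add, Finset.sum_add_distrib, ← Finset.sum_mul, hμ_sum, one_mul,
          mul_left_comm (μ _) (2 * γ k), ← Finset.mul_sum]

theorem IsTrajectory.sum_mul_le_of_tendsto [FiniteDimensional ℝ E] [FiniteDimensional ℝ F]
    (hX : Convex ℝ X) (hf : ∀ i, StrictlyConvexConcave (f i)) (hL : SubgradientBound X Y f L)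
    (hγ : ∀ k, 0 ≤ γ k) (hγ_div : ¬ Summable γ) (hγ_sq : Summable fun k => γ k ^ 2)
    {μ : Fin n → ℝ} (hμ : ∀ i, 0 < μ i) (hμ_sum : ∑ i, μ i = 1) {x : ℕ → Fin n → E}
    {y : ℕ → Fin n → F} (h : IsTrajectory X Y f (fun _ => WeightedDigraph.ofVector μ hμ) γ x y)
    (hx : ∀ k i, x k i ∈ X) (hy : ∀ k i, y k i ∈ Y) {a : E} {b : F}
    (hxa : ∀ i, Tendsto (fun k => x k i) atTop (𝓝 a))
    (hyb : ∀ i, Tendsto (fun k => y k i) atTop (𝓝 b)) (ha : a ∈ X) {w : E} (hw : w ∈ X) :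
    ∑ i, μ i * f i a b ≤ ∑ i, μ i * f i w b := by
  have h_mean_mem : ∀ k, ∑ j, μ j • x k j ∈ X := fun k =>
    hX.sum_mem (fun j _ => (hμ j).le) hμ_sum fun j _ => hx k j
  have h_mean : Tendsto (fun k => ∑ j, μ j • x k j) atTop (𝓝 a) := by
    have := tendsto_finsetSum Finset.univ fun j _ => (hxa j).const_smul (μ j)
    rwa [← Finset.sum_smul, hμ_sum, one_smul] at this
  have h_gain : Tendsto (fun k => ∑ i, μ i * (f i w (y k i) - f i (∑ j, μ j • x k j) (y k i)))
      atTop (𝓝 (∑ i, μ i * (f i w b - f i a b))) :=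
    tendsto_finsetSum _ fun i _ => (((((hf i).continuous_right w).tendsto b).comp (hyb i)).sub
      (hL.tendsto_apply hf h_mean_mem ha (fun k => hy k i) h_mean (hyb i) i)).const_mul (μ i)
  by_contra! h_lt
  obtain ⟨c, hc_gain, hc⟩ : ∃ c, ∑ i, μ i * (f i w b - f i a b) < -c ∧ 0 < c := by
    simp only [mul_sub, Finset.sum_sub_distrib]
    obtain ⟨c, hc, hc_lt⟩ := exists_between (sub_pos.2 h_lt)
    exact ⟨c, by linarith, hc⟩
  refine hγ_div ((summable_mul_left_iff (mul_pos two_pos hc).ne').1 ?_)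
  refine summable_of_eventually_add_le (M := fun k => ∑ i, μ i * ‖x k i - w‖ ^ 2)
    (fun k => Finset.sum_nonneg fun i _ => mul_nonneg (hμ i).le (sq_nonneg _))
    (hγ_sq.mul_left (L ^ 2)) (fun k => mul_nonneg (by positivity) (hγ k)) ?_
  filter_upwards [h_gain.eventually_lt_const hc_gain] with k hk
  have h_gain_le := mul_le_mul_of_nonneg_left hk.le (hγ k)
  linarith [h.sum_mul_norm_sub_sq_le hX hL hμ hμ_sum (hγ k) (hx k) (hy k) hw]

theorem exists_isSaddle_sum_and_isSaddle_sum_mul [FiniteDimensional ℝ E] [FiniteDimensional ℝ F]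
    (hXne : X.Nonempty) (hXc : IsClosed X) (hX : Convex ℝ X) (hYne : Y.Nonempty) (hYc : IsClosed Y)
    (hY : Convex ℝ Y) (hf : ∀ i, StrictlyConvexConcave (f i)) (hL : SubgradientBound X Y f L)
    (hγ : ∀ k, 0 ≤ γ k) (hγ_div : ¬ Summable γ) (hγ_sq : Summable fun k => γ k ^ 2)
    {μ : Fin n → ℝ} (hμ : ∀ i, 0 < μ i) (hμ_sum : ∑ i, μ i = 1)
    (hN : AchievesNash X Y f (fun _ => WeightedDigraph.ofVector μ hμ) γ) :
    ∃ a b, IsSaddle X Y (fun x y => ∑ i, f i x y) a b ∧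
      IsSaddle X Y (fun x y => ∑ i, μ i * f i x y) a b := by
  obtain ⟨x₀, hx₀⟩ := hXne
  obtain ⟨y₀, hy₀⟩ := hYne
  obtain ⟨x, y, h, h_zero_x, h_zero_y⟩ := exists_isTrajectory ⟨x₀, hx₀⟩ hXc hX ⟨y₀, hy₀⟩ hYc hY hf
    (fun _ => WeightedDigraph.ofVector μ hμ) γ (fun _ => x₀) (fun _ => y₀)
  have hx : ∀ k i, x k i ∈ X
    | 0, _ => h_zero_x ▸ hx₀
    | k + 1, i => (h.succ_mem k i).1
  have hy : ∀ k i, y k i ∈ Y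
    | 0, _ => h_zero_y ▸ hy₀
    | k + 1, i => (h.succ_mem k i).2
  obtain ⟨a, b, hab, hxa, hyb⟩ := hN x y h
  refine ⟨a, b, hab, hab.1, hab.2.1, fun v hv => ?_, fun w hw => ?_⟩
  · simpa using h.neg_swap.sum_mul_le_of_tendsto hY (fun i => (hf i).neg_swap) hL.neg_swap hγ
      hγ_div hγ_sq hμ hμ_sum hy hx hyb hxa hab.2.1 hv
  · exact h.sum_mul_le_of_tendsto hX hf hL hγ hγ_div hγ_sq hμ hμ_sum hx hy hxa hyb hab.1 hw

theorem apply_le_of_forall_sum_mul_le {ι : Type*} [Fintype ι] {g g' : ι → ℝ}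
    (h : ∀ μ : ι → ℝ, (∀ i, 0 < μ i) → ∑ i, μ i = 1 → ∑ i, μ i * g i ≤ ∑ i, μ i * g' i) (i : ι) :
    g i ≤ g' i := by
  classical
  have hι : 0 < (Fintype.card ι : ℝ) := Nat.cast_pos.2 (Fintype.card_pos_iff.2 ⟨i⟩)
  let μ : ℝ → ι → ℝ := fun t j => (1 - t) * Pi.single (M := fun _ => ℝ) i 1 j
    + t * (Fintype.card ι : ℝ)⁻¹
  have hμ_pos : ∀ t ∈ Set.Ioo (0 : ℝ) 1, ∀ j, 0 < μ t j := fun t ht j =>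
    add_pos_of_nonneg_of_pos
      (mul_nonneg (sub_nonneg.2 ht.2.le) ((single_mem_stdSimplex ℝ i).1 j))
      (mul_pos ht.1 (inv_pos.2 hι))
  have sum_μ_mul : ∀ t (φ : ι → ℝ),
      ∑ j, μ t j * φ j = (1 - t) * φ i + t * ((Fintype.card ι : ℝ)⁻¹ * ∑ j, φ j) := fun t φ => by
    simp [μ, add_mul, Finset.sum_add_distrib, mul_assoc, ← Finset.mul_sum, Pi.single_apply]
  have hμ_sum : ∀ t, ∑ j, μ t j = 1 := fun t => by
    simpa [hι.ne'] using sum_μ_mul t 1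
  have hμ_tendsto : ∀ φ : ι → ℝ,
      Tendsto (fun t => ∑ j, μ t j * φ j) (𝓝[>] 0) (𝓝 (φ i)) := fun φ => by
    have h_cont : Continuous fun t => ∑ j, μ t j * φ j := by fun_prop
    simpa [sum_μ_mul] using (h_cont.tendsto 0).mono_left nhdsWithin_le_nhds
  refine le_of_tendsto_of_tendsto (hμ_tendsto g) (hμ_tendsto g') ?_
  filter_upwards [Ioo_mem_nhdsGT one_pos] with t ht
  exact h _ (hμ_pos t ht) (hμ_sum t)

theorem exists_forall_isSaddle_of_achievesNash [Nonempty (Fin n)] [FiniteDimensional ℝ E]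
    [FiniteDimensional ℝ F] (hXne : X.Nonempty) (hXc : IsClosed X) (hX : Convex ℝ X)
    (hYne : Y.Nonempty) (hYc : IsClosed Y) (hY : Convex ℝ Y)
    (hf : ∀ i, StrictlyConvexConcave (f i)) (hbounded : BoundedSubgradients X Y f)
    (hγ : ∀ k, 0 ≤ γ k) (hγ_div : ¬ Summable γ) (hγ_sq : Summable fun k => γ k ^ 2)
    (hN : ∀ G : ℕ → WeightedDigraph n, UJSC G → WeightRule G → AchievesNash X Y f G γ) :
    ∃ a b, ∀ i, IsSaddle X Y (f i) a b := by
  obtain ⟨L, -, hL⟩ := hbounded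
  have h_pair := fun (μ : Fin n → ℝ) (hμ : ∀ i, 0 < μ i) (hμ_sum : ∑ i, μ i = 1) =>
    exists_isSaddle_sum_and_isSaddle_sum_mul hXne hXc hX hYne hYc hY hf hL hγ hγ_div hγ_sq hμ
      hμ_sum (hN _ (uJSC_ofVector hμ) (weightRule_ofVector hμ hμ_sum))
  obtain ⟨a, b, hab, -⟩ := h_pair (fun _ => (Fintype.card (Fin n) : ℝ)⁻¹)
    (fun _ => inv_pos.2 (Nat.cast_pos.2 Fintype.card_pos)) stdSimplex.barycenter.2.2
  have h_saddle : ∀ μ : Fin n → ℝ, (∀ i, 0 < μ i) → ∑ i, μ i = 1 →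
      IsSaddle X Y (fun x y => ∑ i, μ i * f i x y) a b := by
    intro μ hμ hμ_sum
    obtain ⟨u, v, huv, huv_μ⟩ := h_pair μ hμ hμ_sum
    obtain ⟨rfl, rfl⟩ := Prod.mk.inj (hab.unique hX hY (.sum hf) huv)
    exact huv_μ
  exact ⟨a, b, fun i => ⟨hab.1, hab.2.1,
    fun v hv => apply_le_of_forall_sum_mul_le
      (fun μ hμ hμ_sum => (h_saddle μ hμ hμ_sum).2.2.1 v hv) i,
    fun u hu => apply_le_of_forall_sum_mul_le
      (fun μ hμ hμ_sum => (h_saddle μ hμ hμ_sum).2.2.2 u hu) i⟩⟩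

end Necessity

theorem theorem3_general {E F : Type*} [NormedAddCommGroup E] [InnerProductSpace ℝ E]
    [FiniteDimensional ℝ E] [NormedAddCommGroup F] [InnerProductSpace ℝ F]
    [FiniteDimensional ℝ F] {n : ℕ} (hn : 0 < n) {X : Set E} {Y : Set F} (hXne : X.Nonempty)
    (hYne : Y.Nonempty) (hXclosed : IsClosed X) (hXconvex : Convex ℝ X) (hYclosed : IsClosed Y)
    (hYconvex : Convex ℝ Y) {f : Fin n → E → F → ℝ} (hf : ∀ i, StrictlyConvexConcave (f i))
    (hbounded : BoundedSubgradients X Y f) {γ : ℕ → ℝ} (hγ_nonneg : ∀ k, 0 ≤ γ k)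
    (hγ_div : ¬ Summable γ) (hγ_sq : Summable fun k => γ k ^ 2) :
    (∀ G : ℕ → WeightedDigraph n, UJSC G → WeightRule G → AchievesNash X Y f G γ) ↔
      ∃ a b, ∀ i, IsSaddle X Y (f i) a b := by
  have : Nonempty (Fin n) := ⟨⟨0, hn⟩⟩
  refine ⟨exists_forall_isSaddle_of_achievesNash hXne hXclosed hXconvex hYne hYclosed hYconvex hf
    hbounded hγ_nonneg hγ_div hγ_sq, ?_⟩
  rintro ⟨a, b, hab⟩ G hU hG
  exact achievesNash_of_forall_isSaddle hXclosed hXconvex hYclosed hYconvex hf hbounded hU hG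
    hγ_nonneg hγ_div hγ_sq hab

theorem theorem3 {n m₁ m₂ : ℕ} (hn : 0 < n)
    (X : Set (EuclideanSpace ℝ (Fin m₁))) (Y : Set (EuclideanSpace ℝ (Fin m₂)))
    (hXclosed : IsClosed X) (hXconvex : Convex ℝ X)
    (hYclosed : IsClosed Y) (hYconvex : Convex ℝ Y)
    (f : Fin n → EuclideanSpace ℝ (Fin m₁) → EuclideanSpace ℝ (Fin m₂) → ℝ)
    (hf : ∀ i, StrictlyConvexConcave (f i))
    (hsaddle : SaddlePointsExist X Y f)
    (hbounded : BoundedSubgradients X Y f)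
    (γ : ℕ → ℝ) (hγ : StepsizeRule γ) :
    (∀ G : ℕ → WeightedDigraph n, UJSC G → WeightRule G → AchievesNash X Y f G γ) ↔
      ∃ a b, ∀ i, IsSaddle X Y (f i) a b := by
  obtain ⟨a, b, ha, hb, -⟩ := hsaddle _ (single_mem_stdSimplex ℝ ⟨0, hn⟩)
  have hγ_nonneg := fun k => (hγ.1 k).le
  exact theorem3_general hn ⟨a, ha⟩ ⟨b, hb⟩ hXclosed hXconvex hYclosed hYconvex hf hbounded
    hγ_nonneg ((not_summable_iff_tendsto_nat_atTop_of_nonneg hγ_nonneg).2 hγ.2.2.1) hγ.2.2.2
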